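/- **Setting.** Functions on the cylinder $\mathbb{C}/\langle i\rangle$ are functions on $\mathbb{C}$ of period $i$, and a sequence in $\mathbb{C}/\langle i\rangle$ is *divergent* if it leaves every compact set. A meromorphic function $g$ on $\mathbb{C}/\langle i\rangle$ is *quasiperiodic* if 1. there is $C>0$ such that any two distinct points of $g^{-1}(\{0,\infty\})$ have distance at least $C$, and each point of $g^{-1}(\{0,\infty\})$ has distance less than $1/C$ from some other point of it; 2. for every divergent sequence $(z_k)$ some subsequence of $g_k(z)=g(z+z_k)$ converges, uniformly on compact sets as maps to the Riemann sphere, to a non-constant meromorphic function $g_\infty$ on $\mathbb{C}/\langle i\rangle$. $\mathcal W$ is the set of quasiperiodic $g$ with divisor $\prod_{j\in\mathbb Z}p_j^2q_j^{-2}$ (infinitely many zeros $p_j$ and poles $q_j$, all of order two). $T_g\mathcal W$ is the space of meromorphic functions on $\mathbb{C}/\langle i\rangle$ with divisor $\ge\prod_j p_jq_j^{-3}$. $\mathcal M_{\rm imm}$ is the set of $g\in\mathcal W$ with $$\overline{\int_\gamma \frac{dz}{g}}=\int_\gamma g\,dz,\qquad \operatorname{Res}_{p_j}\frac{dz}{g}=\operatorname{Res}_{q_j}(g\,dz)=0\quad\text{for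 all } j,$$ where $\gamma$ is a vertical circle $\{\operatorname{Re} z=x\}$ in $\mathbb{C}/\langle i\rangle$, traversed once upwards, that avoids the zeros and poles of $g$. For $g\in\mathcal W$ let $N=\big(\tfrac{2\operatorname{Re} g}{1+|g|^2},\tfrac{2\operatorname{Im} g}{1+|g|^2},\tfrac{|g|^2-1}{1+|g|^2}\big)$, and let $B(g)$ be the branch locus of $g$ (it contains $g^{-1}(\{0,\infty\})$). A *Jacobi function* of $g$ is a smooth real function $v$ on $(\mathbb{C}/\langle i\rangle)\setminus g^{-1}(\{0,\infty\})$ with $$v_{z\bar z}+2\frac{|g'|^2}{(1+|g|^2)^2}v=0 .$$ $\mathcal J_{\mathbb C}(g)$ is the space of functions $f=v+iv^*$ such that $v$ and $v^*$ are Jacobi functions of $g$ and $v^*$ is conjugate to $v$, i.e. off $B(g)$ one has $f=\langle Y,N\rangle$ for a holomorphic map $Y\colon(\mathbb{C}/\langle i\rangle)\setminus B(g)\to\mathbb{C}^3$ with $\langle Y',N\rangle=0$ ($\langle\cdot,\cdot\rangle$ is complex bilinear). Such an $f$ is *quasiperiodic* if for every divergent $(z_k)$ there is a subsequence along which $g(z+z_k)$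 converges to a non-constant meromorphic $g_\infty$ as in 2 and $f(z+z_k)$ converges uniformly on compact subsets of $(\mathbb{C}/\langle i\rangle)\setminus g_\infty^{-1}(\{0,\infty\})$. Let $\mathcal P_n(u)$ be the polynomials in $u,u',u'',\dots$ with $\mathcal P_0=\tfrac12$, $\partial_z\mathcal P_{n+1}(u)=(\partial_{zzz}+4u\,\partial_z+2u')\mathcal P_n(u)$, where $\mathcal P_{n+1}$ has no constant term. The *Shiffman hierarchy* of $g$ consists of the flows $$\frac{\partial g}{\partial t_n}=-2\,\partial_z\big(g\,\mathcal P_n(u)\big),\qquad u=-\frac{3(g')^2}{4g^2}+\frac{g''}{2g},\qquad n\ge 0 .$$ **Theorem.** Let $g\in\mathcal M_{\rm imm}$ and $n\ge0$. Then $\frac{\partial g}{\partial t_n}\in T_g\mathcal W$, and there is a meromorphic function $h_n$ on $\mathbb{C}/\langle i\rangle$, a rational expression of $g$ and its derivatives, with $$\frac{\partial g}{\partial t_n}=\Big(\frac{g^3h_n'}{2g'}\Big)'$$ such that the function $$f(h_n)=\frac{g^2h_n'}{g'}+\frac{2g\,h_n}{1+|g|^2}$$ extends (from the complement of $B(g)$)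 to a smooth function on $\mathbb{C}/\langle i\rangle$ which belongs to $\mathcal J_{\mathbb C}(g)$, is bounded on $\mathbb{C}/\langle i\rangle$ and is quasiperiodic. -/

import Mathlib

namespace Shiffman

/-! ### Differential polynomials and the operators `P_n(u)` -/

section KdV

open MvPolynomial

/-- Differential polynomials with complex coefficients in one unknown `u`;
the variable `X k` stands for the `k`-th derivative of `u`. -/
abbrev DiffPoly : Type := MvPolynomial ℕ ℂ

/-- The total derivative `∂_z` on differential polynomials, sending `u^{(k)}` to `u^{(k+1)}`. -/
noncomputable def dz : Derivation ℂ DiffPoly DiffPoly :=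
  mkDerivation ℂ fun k => X (k + 1)

/-- The differential polynomials `P_n` of the KdV hierarchy, given by `P_0 = 1/2`,
`∂_z P_{n+1} = (∂_zzz + 4 u ∂_z + 2 u') P_n` and the normalisation that `P_{n+1}` has no constant
term (so `P_1 = u`, `P_2 = u'' + 3 u^2`, ...). The code is the recurrence law multiplied by
an integrating factor and integrated once, which shows that a primitive exists among differential
polynomials; the law and the normalisation are proved in `kdvP_zero`, `dz_kdvP_succ` and
`constantCoeff_kdvP_succ`. -/
noncomputable def kdvP : ℕ → DiffPoly
  | 0 => C (1 / 2)
  | n + 1 =>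
      2 * (∑ k : Fin (n + 1),
        (kdvP k * dz (dz (kdvP (n - k))) - C (1 / 2) * (dz (kdvP k) * dz (kdvP (n - k)))
          + 2 * X 0 * (kdvP k * kdvP (n - k))))
      - ∑ k : Fin n, kdvP (k + 1) * kdvP (n - k)
  decreasing_by all_goals omega

theorem kdvP_zero : kdvP 0 = C (1 / 2) := by
  rw [kdvP]

theorem dz_X (k : ℕ) : dz (X k) = X (k+1) := by simp [dz]
theorem dz_C (a : ℂ) : dz (C a) = 0 := by simp [dz]

/-- The operator `∂_zzz + 4 u ∂_z + 2 u'` of the recurrence law. -/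
noncomputable def lawOp (P : DiffPoly) : DiffPoly :=
  dz (dz (dz P)) + 4 * X 0 * dz P + 2 * X 1 * P

theorem kdvP_quad (n : ℕ) :
    ∑ k ∈ Finset.range (n+1), (kdvP k * dz (dz (kdvP (n - k))) - C (1 / 2) * (dz (kdvP k) * dz (kdvP (n - k)))
          + 2 * X 0 * (kdvP k * kdvP (n - k)))
      = C (1/2) * ∑ k ∈ Finset.range (n+2), kdvP k * kdvP (n + 1 - k) := by
  have h : kdvP (n+1) = 2 * (∑ k ∈ Finset.range (n+1), (kdvP k * dz (dz (kdvP (n - k))) - C (1 / 2) * (dz (kdvP k) * dz (kdvP (n - k)))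
          + 2 * X 0 * (kdvP k * kdvP (n - k)))) - ∑ k ∈ Finset.range n, kdvP (k + 1) * kdvP (n - k) := by
    rw [kdvP, Finset.sum_range, Finset.sum_range]
  have e : ∑ k ∈ Finset.range (n+2), kdvP k * kdvP (n + 1 - k) = kdvP (n+1) +
      ∑ k ∈ Finset.range n, kdvP (k + 1) * kdvP (n - k) := by
    rw [Finset.sum_range_succ, Finset.sum_range_succ']
    have e2 : (C (1/2) + C (1/2) : DiffPoly) = 1 := by rw [← C_add]; norm_num
    simp only [Nat.sub_self, Nat.sub_zero, kdvP_zero, Nat.add_sub_add_right]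
    linear_combination kdvP (n+1) * e2
  have e3 : (2 * C (1/2) : DiffPoly) = 1 := by
    rw [two_mul, ← C_add]; norm_num
  rw [e]
  linear_combination (-C (1/2)) * h - (∑ k ∈ Finset.range (n+1), (kdvP k * dz (dz (kdvP (n - k))) - C (1 / 2) * (dz (kdvP k) * dz (kdvP (n - k)))
          + 2 * X 0 * (kdvP k * kdvP (n - k)))) * e3

theorem sum_symm (n : ℕ) (F G : ℕ → DiffPoly) :
    ∑ k ∈ Finset.range (n+1), F k * G (n - k) = ∑ k ∈ Finset.range (n+1), G k * F (n-k) := by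
  rw [← Finset.sum_range_reflect]
  refine Finset.sum_congr rfl fun k hk => ?_
  have := Finset.mem_range.1 hk
  rw [mul_comm]
  congr 2; omega

/-- The recurrence law of the KdV hierarchy. -/
theorem dz_kdvP_succ (n : ℕ) : dz (kdvP (n+1)) = lawOp (kdvP n) := by
  induction n using Nat.strong_induction_on with
  | _ n ih =>
  have q := congrArg dz (kdvP_quad n)
  have e3 : (2 * C (1/2) : DiffPoly) = 1 := by
    rw [two_mul, ← C_add]; norm_num
  have r : dz (C (1/2) * ∑ k ∈ Finset.range (n+2), kdvP k * kdvP (n + 1 - k))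
      = ∑ k ∈ Finset.range (n+2), kdvP k * dz (kdvP (n + 1 - k)) := by
    rw [Derivation.leibniz, dz_C, map_sum]
    simp only [Derivation.leibniz, smul_eq_mul, Finset.sum_add_distrib, mul_zero, add_zero]
    have := sum_symm (n+1) kdvP (fun k => dz (kdvP k))
    have h2 : ∑ k ∈ Finset.range (n+2), kdvP (n + 1 - k) * dz (kdvP k) = ∑ k ∈ Finset.range (n+2), kdvP k * dz (kdvP (n + 1 - k)) := by
      rw [this]; exact Finset.sum_congr rfl fun k _ => mul_comm _ _
    rw [h2]
    linear_combination (∑ k ∈ Finset.range (n+2), kdvP k * dz (kdvP (n + 1 - k))) * e3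
  have l : dz (∑ k ∈ Finset.range (n+1), (kdvP k * dz (dz (kdvP (n - k))) - C (1 / 2) * (dz (kdvP k) * dz (kdvP (n - k)))
          + 2 * X 0 * (kdvP k * kdvP (n - k)))) = ∑ k ∈ Finset.range (n+1), kdvP k * lawOp (kdvP (n - k)) := by
    rw [map_sum]
    have h1 := sum_symm n (fun k => dz (kdvP k)) (fun k => dz (dz (kdvP k)))
    have h2 := sum_symm n kdvP (fun k => dz (kdvP k))
    have h3 : ∀ k, dz (kdvP k * dz (dz (kdvP (n - k))) - C (1 / 2) * (dz (kdvP k) * dz (kdvP (n - k)))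
          + 2 * X 0 * (kdvP k * kdvP (n - k))) = kdvP k * lawOp (kdvP (n - k))
          + (C (1/2) * (dz (kdvP k) * dz (dz (kdvP (n-k))) - dz (dz (kdvP k)) * dz (kdvP (n-k)))
          - 2 * X 0 * (kdvP k * dz (kdvP (n - k)) - dz (kdvP k) * kdvP (n-k))) := by
      intro k
      have h2' : dz (2 * X 0) = 2 * X 1 := by
        rw [two_mul, two_mul, map_add, dz_X]
      simp only [map_add, map_sub, Derivation.leibniz, smul_eq_mul, dz_C, h2', lawOp]
      linear_combination (- dz (kdvP k) * dz (dz (kdvP (n-k)))) * e3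
    rw [Finset.sum_congr rfl fun k _ => h3 k, Finset.sum_add_distrib, Finset.sum_sub_distrib,
      ← Finset.mul_sum, ← Finset.mul_sum, Finset.sum_sub_distrib, Finset.sum_sub_distrib, h1, h2]
    ring
  rw [r, l, Finset.sum_range_succ _ (n+1), Nat.sub_self, kdvP_zero, dz_C, mul_zero, add_zero,
    Finset.sum_range_succ', Finset.sum_range_succ' _ n] at q
  have c : ∑ k ∈ Finset.range n, kdvP (k+1) * lawOp (kdvP (n - (k+1)))
      = ∑ k ∈ Finset.range n, kdvP (k+1) * dz (kdvP (n + 1 - (k+1))) := by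
    refine Finset.sum_congr rfl fun k hk => ?_
    have := Finset.mem_range.1 hk
    rw [← ih (n - (k+1)) (by omega)]
    congr 3; omega
  rw [c] at q
  have q' := add_left_cancel q
  rw [kdvP_zero, Nat.sub_zero, Nat.sub_zero] at q'
  linear_combination (-2) * q' + (lawOp (kdvP n) - dz (kdvP (n+1))) * e3

theorem constantCoeff_dz (P : DiffPoly) : constantCoeff (dz P) = 0 := by
  induction P using MvPolynomial.induction_on with
  | C a => simp
  | add p q hp hq => simp [hp, hq]
  | mul_X p k h => simp [Derivation.leibniz, dz_X, h]

theorem constantCoeff_kdvP_succ (n : ℕ) : constantCoeff (kdvP (n+1)) = 0 := by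
  induction n using Nat.strong_induction_on with
  | _ n ih =>
  rw [kdvP]
  simp only [map_sub, map_mul, map_sum, map_add, constantCoeff_dz, constantCoeff_X]
  have : ∑ x : Fin n, constantCoeff (kdvP (↑x + 1)) * constantCoeff (kdvP (n - ↑x)) = 0 :=
    Finset.sum_eq_zero fun x _ => by rw [ih x x.2, zero_mul]
  rw [this]; simp

theorem kdvP_one : kdvP 1 = X 0 := by
  have e3 : (2 * C (1/2) : DiffPoly) = 1 := by
    rw [two_mul, ← C_add]; norm_num
  rw [kdvP]
  simp [kdvP_zero, -one_div]
  linear_combination (X 0) * (2 * C (1/2) + 1) * e3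

theorem kdvP_two : kdvP 2 = X 2 + 3 * X 0 ^ 2 := by
  have e3 : (2 * C (1/2) : DiffPoly) = 1 := by
    rw [two_mul, ← C_add]; norm_num
  rw [kdvP]; simp [Fin.sum_univ_two, kdvP_zero, dz_X, kdvP_one, -one_div]
  linear_combination (X 2  + 4 * X 0^2) * e3

end KdV

noncomputable section

open scoped Topology ContDiff
open Filter Complex

/-- The value at `z` of the differential polynomial `P` evaluated on the function `u`. -/
def evalDiff (P : DiffPoly) (u : ℂ → ℂ) (z : ℂ) : ℂ :=
  MvPolynomial.aeval (fun k => iteratedDeriv k u z) P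

/-! ### Meromorphic functions on the cylinder `ℂ / ⟨i⟩`

Functions on `ℂ / ⟨i⟩` are functions on `ℂ` with period `i`. A meromorphic function is represented
by its normal form: it has the correct value at every point which is not a pole, and
the value `0` at its poles, which are detected by `meromorphicOrderAt`. -/

/-- `g` is a meromorphic function on `ℂ / ⟨i⟩` (in normal form). -/
structure IsCylMeromorphic (g : ℂ → ℂ) : Prop where
  normalForm : MeromorphicNFOn g Set.univ
  periodic : ∀ z, g (z + I) = g z

/-- `(ℂ / ⟨i⟩) - g⁻¹({0, ∞})`, lifted to `ℂ`. -/
def regularSet (g : ℂ → ℂ) : Set ℂ := {z | meromorphicOrderAt g z = 0}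

/-- `g⁻¹({0, ∞})`, lifted to `ℂ`. -/
def zerosPoles (g : ℂ → ℂ) : Set ℂ := (regularSet g)ᶜ

/-- `(ℂ / ⟨i⟩) - B(g)`, lifted to `ℂ`, where `B(g)` is the branch locus of `g`, for a function `g`
whose zeros and poles are all multiple (so that they belong to `B(g)`). -/
def unbranchedSet (g : ℂ → ℂ) : Set ℂ := {z ∈ regularSet g | deriv g z ≠ 0}

open Classical in
/-- The map into the unit sphere of `ℝ³` whose stereographic projection from the north pole
is `g`. -/
def gaussMap (g : ℂ → ℂ) (z : ℂ) : Fin 3 → ℝ :=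
  if meromorphicOrderAt g z < 0 then ![0, 0, 1]
  else ![2 * (g z).re / (‖g z‖ ^ 2 + 1), 2 * (g z).im / (‖g z‖ ^ 2 + 1),
    (‖g z‖ ^ 2 - 1) / (‖g z‖ ^ 2 + 1)]

/-- A sequence in `ℂ / ⟨i⟩` (lifted to `ℂ`) which diverges, i.e. leaves every compact set of
`ℂ / ⟨i⟩`. -/
def IsDivergent (a : ℕ → ℂ) : Prop := Tendsto (fun k => |(a k).re|) atTop atTop

/-- The translates `z ↦ g (z + a k)` converge to `G`, uniformly on compact sets,
as maps into the Riemann sphere (identified with the unit sphere of `ℝ³`). -/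
def TranslatesTendTo (g : ℂ → ℂ) (a : ℕ → ℂ) (G : ℂ → ℂ) : Prop :=
  TendstoLocallyUniformly (fun k z => gaussMap g (z + a k)) (gaussMap G) atTop

/-- `z` and `w` are lifts of the same point of `ℂ / ⟨i⟩`. -/
def SamePoint (z w : ℂ) : Prop := ∃ m : ℤ, z - w = m * I

/-- Quasiperiodic meromorphic functions on `ℂ / ⟨i⟩`. (The distance of two points of `ℂ / ⟨i⟩` is the
smallest distance of two lifts, and `zerosPoles g` contains all lifts of its points.) -/
structure IsQuasiperiodic (g : ℂ → ℂ) : Prop extends IsCylMeromorphic g where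
  separation : ∃ C : ℝ, 0 < C ∧
    (∀ z ∈ zerosPoles g, ∀ w ∈ zerosPoles g, ¬ SamePoint z w → C ≤ ‖z - w‖) ∧
    (∀ z ∈ zerosPoles g, ∃ w ∈ zerosPoles g, ¬ SamePoint z w ∧ ‖z - w‖ < 1 / C)
  translates : ∀ a : ℕ → ℂ, IsDivergent a → ∃ φ : ℕ → ℕ, StrictMono φ ∧
    ∃ G : ℂ → ℂ, IsCylMeromorphic G ∧ (¬ ∃ c, ∀ z, G z = c) ∧ TranslatesTendTo g (a ∘ φ) G

/-- The space `W`: quasiperiodic functions on `ℂ / ⟨i⟩` with divisor `∏_{j ∈ ℤ} p_j² q_j⁻²`, i.e.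
with infinitely many zeros and infinitely many poles in `ℂ / ⟨i⟩` (represented by their lifts to
`0 ≤ Im z < 1`), all of order two. -/
structure MemW (g : ℂ → ℂ) : Prop extends IsQuasiperiodic g where
  order : ∀ z, meromorphicOrderAt g z = 0 ∨ meromorphicOrderAt g z = 2 ∨
    meromorphicOrderAt g z = -2
  infinite_zeros : {z | meromorphicOrderAt g z = 2 ∧ 0 ≤ z.im ∧ z.im < 1}.Infinite
  infinite_poles : {z | meromorphicOrderAt g z = -2 ∧ 0 ≤ z.im ∧ z.im < 1}.Infinite

/-- The meromorphic differential `f dz` has residue `a` at `p`. -/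
def HasResidue (f : ℂ → ℂ) (p a : ℂ) : Prop :=
  ∀ᶠ r in 𝓝[>] (0 : ℝ), (2 * Real.pi * I)⁻¹ * (∮ z in C(p, r), f z) = a

/-- The space `M_imm` of those `g ∈ W` for which the Weierstrass data `(g, dz)` solve the period
problem: `dz / g` has no residue at the zeros of `g`, `g dz` has no residue at the poles of `g`, and
the integral of `g dz` along the generator of the homology of `ℂ / ⟨i⟩` is the conjugate of
the one of `dz / g`. The generator is represented by a circle `Re z = x` without zeros and
poles of `g`; as the residues vanish, the integrals do not depend on `x`. -/
structure MemMimm (g : ℂ → ℂ) : Prop extends MemW g where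
  residue_zero : ∀ p, meromorphicOrderAt g p = 2 → HasResidue (fun z => (g z)⁻¹) p 0
  residue_pole : ∀ q, meromorphicOrderAt g q = -2 → HasResidue g q 0
  period : ∃ x : ℝ, (∀ t : ℝ, (x + t * I : ℂ) ∈ regularSet g) ∧
    starRingEnd ℂ (∫ t in (0 : ℝ)..1, (g (x + t * I))⁻¹ * I) =
      ∫ t in (0 : ℝ)..1, g (x + t * I) * I

/-- The tangent space `T_g W`: meromorphic functions on `ℂ / ⟨i⟩` with divisor `≥ ∏_j p_j q_j⁻³`. -/
structure MemTangent (g F : ℂ → ℂ) : Prop where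
  meromorphic : Meromorphic F
  periodic : ∀ z, F (z + I) = F z
  order_zero : ∀ p, meromorphicOrderAt g p = 2 → 1 ≤ meromorphicOrderAt F p
  order_pole : ∀ q, meromorphicOrderAt g q = -2 → -3 ≤ meromorphicOrderAt F q
  order_regular : ∀ z ∈ regularSet g, 0 ≤ meromorphicOrderAt F z

/-! ### The Shiffman hierarchy -/

/-- The potential `u = -3 (g')² / (4 g²) + g'' / (2 g)`. -/
def potential (g : ℂ → ℂ) (z : ℂ) : ℂ :=
  -3 * deriv g z ^ 2 / (4 * g z ^ 2) + iteratedDeriv 2 g z / (2 * g z)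

/-- The `n`-th flow `∂g/∂t_n = -2 ∂_z (g P_n(u))` of the Shiffman hierarchy. -/
def shiffmanFlow (g : ℂ → ℂ) (n : ℕ) (z : ℂ) : ℂ :=
  -2 * deriv (fun w => g w * evalDiff (kdvP n) (potential g) w) z

/-- `h` is a rational expression of `g` and its derivatives. -/
def IsRationalExpr (g h : ℂ → ℂ) : Prop :=
  ∃ p q : DiffPoly, (∃ z ∈ regularSet g, evalDiff q g z ≠ 0) ∧
    ∀ z ∈ regularSet g, h z * evalDiff q g z = evalDiff p g z

/-- The infinitesimal deformation `(g³ h' / (2 g'))'` defined by `h`, away from `B(g)`. -/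
def deformationOf (g h : ℂ → ℂ) (z : ℂ) : ℂ :=
  deriv (fun w => g w ^ 3 * deriv h w / (2 * deriv g w)) z

/-- The function `f(h) = g² h' / g' + 2 g h / (1 + |g|²)`, away from `B(g)`. -/
def jacobiOf (g h : ℂ → ℂ) (z : ℂ) : ℂ :=
  g z ^ 2 * deriv h z / deriv g z + 2 * g z * h z / (1 + (‖g z‖ : ℂ) ^ 2)

/-! ### Jacobi functions -/

/-- Real Jacobi functions associated to `g`: functions `v` on `(ℂ / ⟨i⟩) - g⁻¹({0, ∞})` with
`v_{z z̄} + 2 |g'|² / (1 + |g|²)² v = 0`; here `v_{z z̄}` is a quarter of the Laplacian of `v`. -/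
structure IsJacobi (g : ℂ → ℂ) (v : ℂ → ℝ) : Prop where
  periodic : ∀ z, v (z + I) = v z
  smooth : ContDiffOn ℝ ∞ v (regularSet g)
  equation : ∀ z ∈ regularSet g,
    Laplacian.laplacian v z / 4 + 2 * ‖deriv g z‖ ^ 2 / (1 + ‖g z‖ ^ 2) ^ 2 * v z = 0

/-- `w` is a globally defined conjugate Jacobi function of the Jacobi function `v`: there is a
holomorphic map `Y : (ℂ / ⟨i⟩) - B(g) → ℂ³` with `⟨Y', N⟩ = 0`, i.e. `Re Y` is a branched minimal
immersion with Gauss map `N` and `Im Y` is the conjugate one, such that `v` is the support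
function of `Re Y` (so that `Re Y` is the immersion `X_v` determined by `v`) and `w` is the
support function of `Im Y = (X_v)^*`. -/
def IsConjugateJacobi (g : ℂ → ℂ) (v w : ℂ → ℝ) : Prop :=
  ∃ Y : ℂ → Fin 3 → ℂ,
    (∀ z, Y (z + I) = Y z) ∧
    DifferentiableOn ℂ Y (unbranchedSet g) ∧
    (∀ z ∈ unbranchedSet g, ∑ j, deriv Y z j * (gaussMap g z j : ℂ) = 0) ∧
    ∀ z ∈ unbranchedSet g, v z = ∑ j, (Y z j).re * gaussMap g z j ∧
      w z = ∑ j, (Y z j).im * gaussMap g z j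

/-- The space `J_ℂ(g)` of the functions `v + i v^*`, where `v` is a Jacobi function associated to `g`
whose conjugate Jacobi function `v^*` is globally defined. -/
structure IsComplexJacobi (g f : ℂ → ℂ) : Prop where
  re : IsJacobi g fun z => (f z).re
  im : IsJacobi g fun z => (f z).im
  conjugate : IsConjugateJacobi g (fun z => (f z).re) fun z => (f z).im

/-- Quasiperiodic Jacobi functions: for every divergent sequence there is a subsequence along which
the translates of `g` converge to a (non-constant) meromorphic `G` and those of `f` converge uniformly
on compact subsets of the complement of `G⁻¹({0, ∞})`. -/
def IsQuasiperiodicJacobi (g f : ℂ → ℂ) : Prop :=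
  ∀ a : ℕ → ℂ, IsDivergent a → ∃ φ : ℕ → ℕ, StrictMono φ ∧
    ∃ G : ℂ → ℂ, IsCylMeromorphic G ∧ (¬ ∃ c, ∀ z, G z = c) ∧ TranslatesTendTo g (a ∘ φ) G ∧
      ∃ F : ℂ → ℂ, TendstoLocallyUniformlyOn (fun k z => f (z + a (φ k))) F atTop (regularSet G)

end

end Shiffman

namespace Shiffman

noncomputable section

open scoped Topology ContDiff
open Filter Complex

/-! ### Differential polynomials in analytic functions -/

/-! Write `P` for `P_n(u)` and `w = 1/g`. Both the deformation `(g³h'/(2g'))'` and the function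
`f(h)` suggest choosing `h` with `h' = 4 P w'`. Then `g³h'/(2g') = -2gP`, so the flow has the
required form, and `f(h) = -4P + 2gh/(1+|g|²)`, an expression without `g'` in the denominator
(`jacobiFun`). Three things remain: the existence of `h`, the behaviour at zeros and poles of `g`,
and the estimates near the ends.

Existence is algebraic. Since `u = a'/2 - a²/4` with `a = g'/g`, the function `w` is locally the
square of a solution of `ψ'' + uψ = 0`. Hence it is annihilated by the skew-adjoint operator `∂³ +
4u∂ + 2u'` of the KdV recurrence. Lagrange's identity for this operator turns `P_{n+1} w'` into an
exact derivative with an explicit primitive (`hasDerivAt_kdvPrimitive`), which is therefore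
single-valued on the cylinder.

The residue conditions control the singularities. At a pole of `g` they make `u`, hence `P` and `h`,
holomorphic. At a zero they give `u = -2/(z-p)² + v` with `v'(p) = 0`, and this shape forces every
`P_n(u)` to have at most a double pole without residue (`HasResidueFreeDoublePole.of_recurrence`).
In `-4P + 2gh` the double poles cancel, and `g²h` is holomorphic; this gives the smooth extension of
`f(h)` (`exists_smooth_jacobiFun`), and the expansion of `gP` gives tangency to `W`.

The Jacobi equation and the holomorphic curve `Y` are direct computations from the formula for `h'`
(`laplacian_jacobiFun`, `isConjugateJacobi_re_im`). Quasiperiodicity holds because `P` and `h` are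
fixed rational expressions in `g` and its derivatives, which converge along with translates of `g`
away from zeros and poles of the limit. Boundedness follows by compactness: an unbounded sequence
would diverge, the translates would subconverge, and the maximum principle on a small disc carries
the bound from a circle avoiding zeros and poles to its centre (`exists_bound_of_translatesTendTo`).
-/

theorem evalDiff_add (P Q : DiffPoly) (u : ℂ → ℂ) (z : ℂ) :
    evalDiff (P + Q) u z = evalDiff P u z + evalDiff Q u z := by simp [evalDiff]

theorem evalDiff_mul (P Q : DiffPoly) (u : ℂ → ℂ) (z : ℂ) :
    evalDiff (P * Q) u z = evalDiff P u z * evalDiff Q u z := by simp [evalDiff]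

theorem evalDiff_C (a : ℂ) (u : ℂ → ℂ) (z : ℂ) : evalDiff (MvPolynomial.C a) u z = a := by
  simp [evalDiff]

theorem evalDiff_X (k : ℕ) (u : ℂ → ℂ) (z : ℂ) :
    evalDiff (MvPolynomial.X k) u z = iteratedDeriv k u z := by simp [evalDiff]

theorem evalDiff_pow (P : DiffPoly) (m : ℕ) (u : ℂ → ℂ) (z : ℂ) :
    evalDiff (P ^ m) u z = evalDiff P u z ^ m := by simp [evalDiff]

theorem analyticAt_iteratedDeriv {u : ℂ → ℂ} {z : ℂ} (hu : AnalyticAt ℂ u z) (k : ℕ) :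
    AnalyticAt ℂ (iteratedDeriv k u) z := by
  induction k with
  | zero => simpa using hu
  | succ k ih => rw [iteratedDeriv_succ]; exact ih.deriv

theorem meromorphicAt_iteratedDeriv {u : ℂ → ℂ} {z : ℂ} (hu : MeromorphicAt u z) (k : ℕ) :
    MeromorphicAt (iteratedDeriv k u) z := by
  induction k with
  | zero => simpa using hu
  | succ k ih => rw [iteratedDeriv_succ]; exact ih.deriv

theorem analyticAt_evalDiff (P : DiffPoly) {u : ℂ → ℂ} {z : ℂ} (hu : AnalyticAt ℂ u z) :
    AnalyticAt ℂ (evalDiff P u) z := by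
  induction P using MvPolynomial.induction_on with
  | C a => exact analyticAt_const.congr (.of_forall fun w => (evalDiff_C a u w).symm)
  | add p q hp hq => exact (hp.add hq).congr (.of_forall fun w => (evalDiff_add p q u w).symm)
  | mul_X p k h =>
    refine (h.mul (analyticAt_iteratedDeriv hu k)).congr (.of_forall fun w => ?_)
    simp [evalDiff_mul, evalDiff_X]

theorem meromorphicAt_evalDiff (P : DiffPoly) {u : ℂ → ℂ} {z : ℂ} (hu : MeromorphicAt u z) :
    MeromorphicAt (evalDiff P u) z := by
  induction P using MvPolynomial.induction_on with
  | C a => exact (MeromorphicAt.const a z).congr (.of_forall fun w => (evalDiff_C a u w).symm)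
  | add p q hp hq => exact (hp.add hq).congr (.of_forall fun w => (evalDiff_add p q u w).symm)
  | mul_X p k h =>
    refine (h.mul (meromorphicAt_iteratedDeriv hu k)).congr (.of_forall fun w => ?_)
    simp [evalDiff_mul, evalDiff_X]

theorem hasDerivAt_iteratedDeriv {u : ℂ → ℂ} {z : ℂ} (hu : AnalyticAt ℂ u z) (k : ℕ) :
    HasDerivAt (iteratedDeriv k u) (iteratedDeriv (k + 1) u z) z := by
  rw [iteratedDeriv_succ]
  exact (analyticAt_iteratedDeriv hu k).differentiableAt.hasDerivAt

theorem hasDerivAt_evalDiff (P : DiffPoly) {u : ℂ → ℂ} {z : ℂ} (hu : AnalyticAt ℂ u z) :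
    HasDerivAt (evalDiff P u) (evalDiff (dz P) u z) z := by
  induction P using MvPolynomial.induction_on with
  | C a =>
    have : evalDiff (MvPolynomial.C a) u = fun _ => a := funext fun w => evalDiff_C a u w
    rw [this, dz_C]
    simpa [evalDiff] using hasDerivAt_const z a
  | add p q hp hq =>
    have : evalDiff (p + q) u = evalDiff p u + evalDiff q u := funext fun w => evalDiff_add p q u w
    rw [this, map_add, evalDiff_add]
    exact hp.add hq
  | mul_X p k h =>
    have : evalDiff (p * MvPolynomial.X k) u = evalDiff p u * iteratedDeriv k u :=
      funext fun w => by simp [evalDiff_mul, evalDiff_X]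
    rw [this, Derivation.leibniz, dz_X, smul_eq_mul, smul_eq_mul, evalDiff_add, evalDiff_mul,
      evalDiff_mul, evalDiff_X, evalDiff_X]
    exact (h.mul (hasDerivAt_iteratedDeriv hu k)).congr_deriv (by ring)

theorem iteratedDeriv_congr_of_eventuallyEq_nhdsNE {u v : ℂ → ℂ} {p : ℂ} (h : u =ᶠ[𝓝[≠] p] v)
    (k : ℕ) : iteratedDeriv k u =ᶠ[𝓝[≠] p] iteratedDeriv k v := by
  induction k with
  | zero => simpa using h
  | succ k ih => rw [iteratedDeriv_succ, iteratedDeriv_succ]; exact ih.nhdsNE_deriv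

theorem evalDiff_congr_of_eventuallyEq_nhdsNE {u v : ℂ → ℂ} {p : ℂ} (h : u =ᶠ[𝓝[≠] p] v)
    (P : DiffPoly) : evalDiff P u =ᶠ[𝓝[≠] p] evalDiff P v := by
  induction P using MvPolynomial.induction_on with
  | C a => exact .of_forall fun w => by simp [evalDiff_C]
  | add p q hp hq =>
    filter_upwards [hp, hq] with w h1 h2
    rw [evalDiff_add, evalDiff_add, h1, h2]
  | mul_X p k hp =>
    filter_upwards [hp, iteratedDeriv_congr_of_eventuallyEq_nhdsNE h k] with w h1 h2
    rw [evalDiff_mul, evalDiff_mul, h1, evalDiff_X, evalDiff_X, h2]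

theorem iteratedDeriv_periodic {u : ℂ → ℂ} (h : ∀ z, u (z + I) = u z) (k : ℕ) (z : ℂ) :
    iteratedDeriv k u (z + I) = iteratedDeriv k u z := by
  have := congrFun (iteratedDeriv_comp_add_const k u I) z
  rw [← this, funext h]

theorem evalDiff_periodic {u : ℂ → ℂ} (h : ∀ z, u (z + I) = u z) (P : DiffPoly) (z : ℂ) :
    evalDiff P u (z + I) = evalDiff P u z := by
  unfold evalDiff
  simp only [iteratedDeriv_periodic h]

theorem deriv_periodic {u : ℂ → ℂ} (h : ∀ z, u (z + I) = u z) (z : ℂ) :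
    deriv u (z + I) = deriv u z := by
  simpa using iteratedDeriv_periodic h 1 z

theorem potential_periodic {g : ℂ → ℂ} (h : ∀ z, g (z + I) = g z) (z : ℂ) :
    potential g (z + I) = potential g z := by
  simp only [potential, iteratedDeriv_periodic h, deriv_periodic h, h]

/-! ### Rational expressions of a function and its derivatives -/

/-- The functional `Φ` is given, where its argument `g` is analytic without zeros, by a
differential polynomial in `g` divided by a power of `g`. -/
def IsRationalFunctional (Φ : (ℂ → ℂ) → ℂ → ℂ) : Prop :=
  ∃ (p : DiffPoly) (m : ℕ), ∀ g z, AnalyticAt ℂ g z → g z ≠ 0 →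
    Φ g z = evalDiff p g z / g z ^ m

namespace IsRationalFunctional

variable {Φ Ψ : (ℂ → ℂ) → ℂ → ℂ}

theorem const (a : ℂ) : IsRationalFunctional fun _ _ => a :=
  ⟨MvPolynomial.C a, 0, fun g z _ _ => by simp [evalDiff_C]⟩

theorem inv : IsRationalFunctional fun g z => (g z)⁻¹ :=
  ⟨MvPolynomial.C 1, 1, fun g z _ _ => by rw [evalDiff_C]; simp⟩

theorem iteratedDeriv_self (k : ℕ) : IsRationalFunctional fun g => iteratedDeriv k g :=
  ⟨MvPolynomial.X k, 0, fun g z _ _ => by simp [evalDiff_X]⟩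

theorem mul (hΦ : IsRationalFunctional Φ) (hΨ : IsRationalFunctional Ψ) :
    IsRationalFunctional fun g z => Φ g z * Ψ g z := by
  obtain ⟨p, m, hp⟩ := hΦ
  obtain ⟨q, l, hq⟩ := hΨ
  refine ⟨p * q, m + l, fun g z h h0 => ?_⟩
  simp only [hp g z h h0, hq g z h h0, evalDiff_mul, pow_add, div_mul_div_comm]

theorem add (hΦ : IsRationalFunctional Φ) (hΨ : IsRationalFunctional Ψ) :
    IsRationalFunctional fun g z => Φ g z + Ψ g z := by
  obtain ⟨p, m, hp⟩ := hΦ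
  obtain ⟨q, l, hq⟩ := hΨ
  refine ⟨p * MvPolynomial.X 0 ^ l + q * MvPolynomial.X 0 ^ m, m + l, fun g z h h0 => ?_⟩
  simp only [hp g z h h0, hq g z h h0, evalDiff_mul, evalDiff_add, evalDiff_pow, evalDiff_X,
    iteratedDeriv_zero]
  rw [div_add_div _ _ (pow_ne_zero m h0) (pow_ne_zero l h0), pow_add]
  ring

theorem congr (hΦ : IsRationalFunctional Φ)
    (h : ∀ g z, AnalyticAt ℂ g z → g z ≠ 0 → Ψ g z = Φ g z) : IsRationalFunctional Ψ := by
  obtain ⟨p, m, hp⟩ := hΦ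
  exact ⟨p, m, fun g z ha h0 => (h g z ha h0).trans (hp g z ha h0)⟩

theorem exists_eventuallyEq {p : DiffPoly} {m : ℕ}
    (hp : ∀ g z, AnalyticAt ℂ g z → g z ≠ 0 → Φ g z = evalDiff p g z / g z ^ m)
    {g : ℂ → ℂ} {z : ℂ} (ha : AnalyticAt ℂ g z) (h0 : g z ≠ 0) :
    Φ g =ᶠ[𝓝 z] fun y => evalDiff p g y / g y ^ m := by
  filter_upwards [ha.eventually_analyticAt, ha.continuousAt.eventually_ne h0] with y h1 h2
  exact hp g y h1 h2

theorem analyticAt (hΦ : IsRationalFunctional Φ) {g : ℂ → ℂ} {z : ℂ} (ha : AnalyticAt ℂ g z)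
    (h0 : g z ≠ 0) : AnalyticAt ℂ (Φ g) z := by
  obtain ⟨p, m, hp⟩ := hΦ
  exact ((analyticAt_evalDiff p ha).div (ha.pow m) (pow_ne_zero m h0)).congr
    (exists_eventuallyEq hp ha h0).symm

theorem deriv (hΦ : IsRationalFunctional Φ) : IsRationalFunctional fun g => deriv (Φ g) := by
  obtain ⟨p, m, hp⟩ := hΦ
  -- Quotient rule: `(p/g^m)' = (p'g - m p g')/g^(m+1)`.
  refine ⟨dz p * MvPolynomial.X 0 + MvPolynomial.C (-m : ℂ) * (p * MvPolynomial.X 1), m + 1,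
    fun g z ha h0 => ?_⟩
  change _root_.deriv (Φ g) z = _
  rw [(exists_eventuallyEq hp ha h0).deriv_eq]
  have h1 := (hasDerivAt_evalDiff p ha).fun_div (ha.differentiableAt.hasDerivAt.fun_pow m)
    (pow_ne_zero m h0)
  rw [h1.deriv, evalDiff_add, evalDiff_mul, evalDiff_mul, evalDiff_mul, evalDiff_C, evalDiff_X, evalDiff_X, iteratedDeriv_zero, iteratedDeriv_one]
  -- The derivative of `g^m` carries the truncated exponent `m - 1`, so `m = 0` is separate.
  rcases m with _ | m
  · simp; field_simp
  · simp only [Nat.add_sub_cancel]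
    field_simp
    ring

theorem iteratedDeriv (hΦ : IsRationalFunctional Φ) (k : ℕ) :
    IsRationalFunctional fun g => iteratedDeriv k (Φ g) := by
  induction k with
  | zero => simpa using hΦ
  | succ k ih => simpa only [iteratedDeriv_succ] using ih.deriv

theorem evalDiff (hΦ : IsRationalFunctional Φ) (P : DiffPoly) :
    IsRationalFunctional fun g => evalDiff P (Φ g) := by
  induction P using MvPolynomial.induction_on with
  | C a => exact (const a).congr fun g z _ _ => evalDiff_C a _ z
  | add p q hp hq => exact (hp.add hq).congr fun g z _ _ => evalDiff_add p q _ z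
  | mul_X p k h =>
    exact (h.mul (hΦ.iteratedDeriv k)).congr fun g z _ _ => by rw [evalDiff_mul, evalDiff_X]

end IsRationalFunctional

/-! ### The functions `P_n(u)` and the primitive of `4 P_n(u) (1/g)'` -/

theorem isRationalFunctional_potential : IsRationalFunctional potential := by
  have i := IsRationalFunctional.inv
  have d1 := IsRationalFunctional.iteratedDeriv_self 1
  have d2 := IsRationalFunctional.iteratedDeriv_self 2
  refine (((IsRationalFunctional.const (-3 / 4)).mul ((d1.mul i).mul (d1.mul i))).add
    ((IsRationalFunctional.const (1 / 2)).mul (d2.mul i))).congr fun g z _ h0 => ?_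
  simp only [potential, iteratedDeriv_one]
  field_simp

/-- `P_n(u)` for the potential `u` of `g`. -/
def kdvFun (n : ℕ) (g : ℂ → ℂ) : ℂ → ℂ := evalDiff (kdvP n) (potential g)

theorem kdvFun_apply (n : ℕ) (g : ℂ → ℂ) (z : ℂ) :
    kdvFun n g z = evalDiff (kdvP n) (potential g) z := rfl

theorem isRationalFunctional_kdvFun (n : ℕ) : IsRationalFunctional (kdvFun n) :=
  isRationalFunctional_potential.evalDiff _

/-- An explicit primitive of `4 P_n(u) (1/g)'`. -/
def kdvPrimitive : ℕ → (ℂ → ℂ) → ℂ → ℂ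
  | 0, g, z => 2 * (g z)⁻¹
  | n + 1, g, z =>
      4 * (evalDiff (kdvP (n + 1)) (potential g) z * (g z)⁻¹
        - evalDiff (dz (dz (kdvP n))) (potential g) z * (g z)⁻¹
        - evalDiff (dz (kdvP n)) (potential g) z * (deriv g z * (g z)⁻¹ ^ 2)
        + evalDiff (kdvP n) (potential g) z *
          (iteratedDeriv 2 g z * (g z)⁻¹ ^ 2 - 2 * deriv g z ^ 2 * (g z)⁻¹ ^ 3)
        - 4 * (potential g z * (evalDiff (kdvP n) (potential g) z * (g z)⁻¹)))

theorem isRationalFunctional_kdvPrimitive (n : ℕ) : IsRationalFunctional (kdvPrimitive n) := by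
  have i := IsRationalFunctional.inv
  have d1 := IsRationalFunctional.iteratedDeriv_self 1
  have d2 := IsRationalFunctional.iteratedDeriv_self 2
  have u := isRationalFunctional_potential
  have c := IsRationalFunctional.const
  cases n with
  | zero => exact (c 2).mul i
  | succ n =>
    refine ((c 4).mul (((((u.evalDiff (kdvP (n + 1))).mul i).add
      ((c (-1)).mul ((u.evalDiff (dz (dz (kdvP n)))).mul i))).add
      ((c (-1)).mul ((u.evalDiff (dz (kdvP n))).mul (d1.mul (i.mul i))))).add
      (((u.evalDiff (kdvP n)).mul ((d2.mul (i.mul i)).add ((c (-2)).mul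
        ((d1.mul d1).mul (i.mul (i.mul i)))))).add
      ((c (-4)).mul (u.mul ((u.evalDiff (kdvP n)).mul i)))))).congr fun g z _ _ => ?_
    simp only [kdvPrimitive, iteratedDeriv_one]
    ring

theorem kdvPrimitive_periodic {g : ℂ → ℂ} (h : ∀ z, g (z + I) = g z) (n : ℕ) (z : ℂ) :
    kdvPrimitive n g (z + I) = kdvPrimitive n g z := by
  cases n <;> simp only [kdvPrimitive, h, iteratedDeriv_periodic h, deriv_periodic h,
    potential_periodic h, evalDiff_periodic (potential_periodic h)]

theorem evalDiff_lawOp (P : DiffPoly) (u : ℂ → ℂ) (z : ℂ) :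
    evalDiff (lawOp P) u z = evalDiff (dz (dz (dz P))) u z + 4 * u z * evalDiff (dz P) u z
      + 2 * deriv u z * evalDiff P u z := by
  simp [lawOp, evalDiff]

/-- With `w = 1/g`, the primitive for `n + 1` is `4(P_{n+1}w - P_n''w + P_n'w' - P_n w'' - 4uP_n
w)`. Differentiating and using the recurrence leaves `4P_{n+1}w' - 4P_n(w''' + 4uw' + 2u'w)`, and
the last bracket vanishes because `w` is the square of a solution of `ψ'' + uψ = 0`. -/
theorem hasDerivAt_kdvPrimitive (n : ℕ) {g : ℂ → ℂ} {z : ℂ} (ha : AnalyticAt ℂ g z)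
    (h0 : g z ≠ 0) :
    HasDerivAt (kdvPrimitive n g) (-4 * kdvFun n g z * deriv g z / g z ^ 2) z := by
  have hg0 := ha.differentiableAt.hasDerivAt
  have hi : HasDerivAt (fun y => (g y)⁻¹) (-deriv g z * (g z)⁻¹ ^ 2) z :=
    (hg0.fun_inv h0).congr_deriv (by rw [div_eq_mul_inv, inv_pow])
  cases n with
  | zero =>
    have : kdvPrimitive 0 g = fun y => 2 * (g y)⁻¹ := rfl
    rw [this]
    refine (hi.const_mul 2).congr_deriv ?_
    rw [kdvFun_apply, kdvP_zero, evalDiff_C]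
    ring
  | succ n =>
    have hu := isRationalFunctional_potential.analyticAt ha h0
    have hg1 : HasDerivAt (deriv g) (iteratedDeriv 2 g z) z := by
      simpa using hasDerivAt_iteratedDeriv ha 1
    have hg2 := hasDerivAt_iteratedDeriv ha 2
    have hP0 := hasDerivAt_evalDiff (kdvP n) hu
    have hP1 := hasDerivAt_evalDiff (dz (kdvP n)) hu
    have hP2 := hasDerivAt_evalDiff (dz (dz (kdvP n))) hu
    have hQ := hasDerivAt_evalDiff (kdvP (n + 1)) hu
    rw [dz_kdvP_succ, evalDiff_lawOp] at hQ
    have hu1 : HasDerivAt (potential g) (-3 / 4 * (2 * deriv g z * iteratedDeriv 2 g z * (g z)⁻¹ ^ 2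
        - 2 * deriv g z ^ 3 * (g z)⁻¹ ^ 3) + 1 / 2 * (iteratedDeriv 3 g z * (g z)⁻¹
        - iteratedDeriv 2 g z * deriv g z * (g z)⁻¹ ^ 2)) z := by
      have : potential g = fun y => -3 / 4 * (deriv g y ^ 2 * (g y)⁻¹ ^ 2)
          + 1 / 2 * (iteratedDeriv 2 g y * (g y)⁻¹) := by
        funext y; simp only [potential]; ring
      rw [this]
      refine ((((hg1.fun_pow 2).mul (hi.fun_pow 2)).const_mul (-3 / 4)).add
        ((hg2.mul hi).const_mul (1 / 2))).congr_deriv ?_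
      simp only [Nat.cast_ofNat, Nat.add_one_sub_one, pow_one, Nat.reduceAdd]
      ring
    have hu2 := hu1.deriv
    rw [hu2] at hQ
    have e : potential g z = -3 / 4 * (deriv g z ^ 2 * (g z)⁻¹ ^ 2)
          + 1 / 2 * (iteratedDeriv 2 g z * (g z)⁻¹) := by simp only [potential]; ring
    have key := (((((hQ.fun_mul hi).fun_sub (hP2.fun_mul hi)).fun_sub (hP1.fun_mul
      (hg1.fun_mul (hi.fun_pow 2)))).fun_add (hP0.fun_mul ((hg2.fun_mul (hi.fun_pow 2)).fun_sub
      (((hg1.fun_pow 2).const_mul 2).fun_mul (hi.fun_pow 3))))).fun_sub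
      ((hu1.fun_mul (hP0.fun_mul hi)).const_mul 4)).const_mul 4
    refine (show HasDerivAt (kdvPrimitive (n + 1) g) _ z from key).congr_deriv ?_
    -- With `u` and `u'` written out in `g` and `(g z)⁻¹`, the remaining content is `w''' + 4uw' +
    -- 2u'w = 0`, a polynomial identity.
    rw [e]
    simp only [kdvFun_apply, Nat.cast_ofNat, Nat.add_one_sub_one, pow_one, Nat.reduceAdd]
    ring

/-! ### Local expansions -/

theorem exists_eq_add_mul {f : ℂ → ℂ} {p : ℂ} (hf : AnalyticAt ℂ f p) :
    ∃ k, AnalyticAt ℂ k p ∧ ∀ᶠ z in 𝓝 p, f z = f p + (z - p) * k z := by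
  have hf' : AnalyticAt ℂ (fun z => f z - f p) p := by fun_prop
  have h : ((1 : ℕ) : ℕ∞) ≤ analyticOrderAt (fun z => f z - f p) p := by
    rw [Nat.cast_one, Order.one_le_iff_ne_zero, hf'.analyticOrderAt_ne_zero]
    simp
  obtain ⟨k, hk, hk'⟩ := (natCast_le_analyticOrderAt hf').1 h
  refine ⟨k, hk, hk'.mono fun z hz => ?_⟩
  simp only [pow_one, smul_eq_mul] at hz
  rw [← hz]
  ring

theorem deriv_eq_of_eq_add_mul {f k : ℂ → ℂ} {p a : ℂ} (hk : AnalyticAt ℂ k p)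
    (h : ∀ᶠ z in 𝓝 p, f z = a + (z - p) * k z) : deriv f p = k p := by
  have h1 : HasDerivAt (fun z => a + (z - p) * k z) (1 * k p + (p - p) * deriv k p) p :=
    (((hasDerivAt_id p).sub_const p).fun_mul hk.differentiableAt.hasDerivAt).const_add a
  rw [EventuallyEq.deriv_eq h, h1.deriv]
  simp

theorem exists_eq_add_sq_mul {f : ℂ → ℂ} {p : ℂ} (hf : AnalyticAt ℂ f p) (h0 : deriv f p = 0) :
    ∃ k, AnalyticAt ℂ k p ∧ ∀ᶠ z in 𝓝 p, f z = f p + (z - p) ^ 2 * k z := by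
  obtain ⟨k, hk, h1⟩ := exists_eq_add_mul hf
  obtain ⟨l, hl, h2⟩ := exists_eq_add_mul hk
  refine ⟨l, hl, ?_⟩
  filter_upwards [h1, h2] with z h1 h2'
  rw [h1, h2', ← deriv_eq_of_eq_add_mul hk ‹_›, h0]
  ring

/-- A meromorphic function whose derivative has a pole of order at most `m + 1` has a pole of order
at most `m`. -/
theorem exists_eq_div_pow_of_deriv {F S : ℂ → ℂ} {p : ℂ} {m : ℕ} (hF : MeromorphicAt F p)
    (hS : AnalyticAt ℂ S p) (h : deriv F =ᶠ[𝓝[≠] p] fun z => S z / (z - p) ^ (m + 1)) :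
    ∃ H, AnalyticAt ℂ H p ∧ F =ᶠ[𝓝[≠] p] fun z => H z / (z - p) ^ m := by
  have hne : ∀ᶠ z in 𝓝[≠] p, z - p ≠ 0 :=
    eventually_mem_nhdsWithin.mono fun z hz => sub_ne_zero.2 hz
  have key : 0 ≤ meromorphicOrderAt (fun z => (z - p) ^ m * F z) p := by
    have e1 (k : ℕ) : meromorphicOrderAt (fun z : ℂ => (z - p) ^ k) p = (k : ℤ) :=
      meromorphicOrderAt_pow_id_sub_const
    rw [show (fun z => (z - p) ^ m * F z) = (fun z => (z - p) ^ m) * F from rfl,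
      meromorphicOrderAt_mul (by fun_prop) hF, e1]
    cases ho : meromorphicOrderAt F p with
    | top => simp
    | coe n =>
      rw [← WithTop.coe_add, ← WithTop.coe_zero, WithTop.coe_le_coe]
      -- If `n < -m`, then `n ≠ 0` and differentiation lowers the order by exactly one, giving a
      -- pole of order above `m + 1`. For `m = 0` this says that a derivative never has a simple
      -- pole.
      by_contra! hlt
      have hn : (n : ℂ) ≠ 0 := by
        have : n ≠ 0 := by omega
        exact_mod_cast this
      have h1 := meromorphicOrderAt_deriv_eq_sub_one hn ho
      have h2 : 0 ≤ meromorphicOrderAt (fun z => (z - p) ^ (m + 1) * deriv F z) p := by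
        rw [meromorphicOrderAt_congr (f₂ := S) (by
          filter_upwards [h, hne] with z hz h0
          rw [hz]; field_simp)]
        exact hS.meromorphicOrderAt_nonneg
      rw [show (fun z => (z - p) ^ (m + 1) * deriv F z) = (fun z => (z - p) ^ (m + 1)) * deriv F
        from rfl, meromorphicOrderAt_mul (by fun_prop) hF.deriv, e1, h1, ← WithTop.coe_add,
        ← WithTop.coe_zero, WithTop.coe_le_coe] at h2
      push_cast at h2
      omega
  obtain ⟨H, hH, hH'⟩ := (MeromorphicAt.meromorphicOrderAt_nonneg_iff (by fun_prop)).1 key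
  refine ⟨H, hH, ?_⟩
  filter_upwards [hH', hne] with z hz h0
  rw [← hz]; field_simp

theorem deriv_div_pow_add {f r : ℂ → ℂ} {p a : ℂ} {m : ℕ} (hr : AnalyticAt ℂ r p)
    (h : f =ᶠ[𝓝[≠] p] fun z => a / (z - p) ^ m + r z) :
    deriv f =ᶠ[𝓝[≠] p] fun z => (-m * a) / (z - p) ^ (m + 1) + deriv r z := by
  refine h.nhdsNE_deriv.trans ?_
  filter_upwards [eventually_mem_nhdsWithin, nhdsWithin_le_nhds hr.eventually_analyticAt]
    with z hz hrz
  have h0 : z - p ≠ 0 := sub_ne_zero.2 hz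
  have h1 := ((((hasDerivAt_id z).sub_const p).fun_pow m).fun_inv (pow_ne_zero m h0)).const_mul a
    |>.fun_add hrz.differentiableAt.hasDerivAt
  simp only [id, ← div_eq_mul_inv] at h1
  rw [h1.deriv]
  rcases m with _ | m
  · simp
  · simp only [Nat.add_sub_cancel]
    push_cast
    field_simp
    ring

/-- A meromorphic function with a double pole without residue. -/
theorem exists_eq_div_sq_of_hasResidue_zero {φ : ℂ → ℂ} {p : ℂ} (hφ : MeromorphicAt φ p)
    (ho : meromorphicOrderAt φ p = -2) (hres : HasResidue φ p 0) :
    ∃ E, AnalyticAt ℂ E p ∧ E p ≠ 0 ∧ deriv E p = 0 ∧ φ =ᶠ[𝓝[≠] p] fun z => E z / (z - p) ^ 2 := by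
  obtain ⟨E, hE, h0, h⟩ := (meromorphicOrderAt_eq_int_iff (n := -2) hφ).1 (by exact_mod_cast ho)
  have h' : φ =ᶠ[𝓝[≠] p] fun z => E z / (z - p) ^ 2 := by
    filter_upwards [h] with z hz
    rw [hz, zpow_neg, smul_eq_mul, div_eq_inv_mul]
    norm_cast
  refine ⟨E, hE, h0, ?_, h'⟩
  obtain ⟨ε, hε, hball⟩ := Metric.eventually_nhds_iff_ball.1
    (hE.eventually_analyticAt.and (eventually_nhdsWithin_iff.1 h'))
  have hev : ∀ᶠ r in 𝓝[>] (0 : ℝ), r < ε := nhdsWithin_le_nhds (Iio_mem_nhds hε)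
  obtain ⟨r, hr, hrε, hr0⟩ := (hres.and (hev.and eventually_mem_nhdsWithin)).exists
  have hr0 : 0 < r := hr0
  have hsub : Metric.closedBall p r ⊆ Metric.ball p ε := Metric.closedBall_subset_ball hrε
  -- Cauchy's formula for the derivative: the residue of `E/(z-p)²` is `E'(p)`.
  rw [← two_pi_I_inv_smul_circleIntegral_sub_sq_inv_smul_of_differentiable Metric.isOpen_ball hsub
    (fun z hz => (hball z hz).1.differentiableAt.differentiableWithinAt)
    (Metric.mem_ball_self hr0), ← hr, smul_eq_mul]
  congr 1
  refine circleIntegral.integral_congr hr0.le fun z hz => ?_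
  have hzp : z ≠ p := by
    rintro rfl
    simp at hz
    exact hr0.ne hz
  change _ = φ z
  rw [(hball z (hsub (Metric.sphere_subset_closedBall hz))).2 hzp, smul_eq_mul]
  exact inv_mul_eq_div _ _

/-- `f` has at most a double pole at `p`, without residue. -/
def HasResidueFreeDoublePole (f : ℂ → ℂ) (p : ℂ) : Prop :=
  ∃ (α : ℂ) (r : ℂ → ℂ), AnalyticAt ℂ r p ∧ f =ᶠ[𝓝[≠] p] fun z => α / (z - p) ^ 2 + r z

/-- The step of the KdV recurrence preserves the shape of the poles at a pole of the potential with
trivial monodromy. -/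
theorem HasResidueFreeDoublePole.of_recurrence {u v f F : ℂ → ℂ} {p : ℂ} (hv : AnalyticAt ℂ v p)
    (hv0 : deriv v p = 0) (hu : u =ᶠ[𝓝[≠] p] fun z => -2 / (z - p) ^ 2 + v z)
    (hf : HasResidueFreeDoublePole f p) (hF : MeromorphicAt F p)
    (h : deriv F =ᶠ[𝓝[≠] p] fun z => deriv (deriv (deriv f)) z + 4 * u z * deriv f z
      + 2 * deriv u z * f z) : HasResidueFreeDoublePole F p := by
  obtain ⟨α, r, hr, hfr⟩ := hf
  obtain ⟨k, hk, hvk⟩ := exists_eq_add_sq_mul hv hv0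
  obtain ⟨l, hl, hvl⟩ := exists_eq_add_mul hv.deriv
  -- The regular part `r` enters the right-hand side through `8(r - (z-p)r')/(z-p)³`. This
  -- combination has vanishing derivative at `p`, so it contributes no double pole.
  have hρ : AnalyticAt ℂ (fun z => r z - (z - p) * deriv r z) p := by fun_prop
  have hρ0 : deriv (fun z => r z - (z - p) * deriv r z) p = 0 := by
    have := (hr.differentiableAt.hasDerivAt).fun_sub
      (((hasDerivAt_id p).sub_const p).fun_mul hr.deriv.differentiableAt.hasDerivAt)
    exact this.deriv.trans (by simp)
  obtain ⟨m, hm, hρm⟩ := exists_eq_add_sq_mul hρ hρ0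
  simp only [sub_self, zero_mul, sub_zero] at hρm
  have f1 := deriv_div_pow_add hr hfr
  have f2 := deriv_div_pow_add hr.deriv f1
  have f3 := deriv_div_pow_add hr.deriv.deriv f2
  have u1 := deriv_div_pow_add hv hu
  -- The `(z-p)⁻⁵` terms cancel (`-24α + 16α + 8α = 0`) and `A` is the coefficient of `(z-p)⁻³`. The
  -- `(z-p)⁻²` coefficient vanishes because `v'(p) = 0`, so after integrating away `A/(z-p)³` only a
  -- possible simple pole remains in the derivative; the case `m = 0` of
  -- `exists_eq_div_pow_of_deriv` excludes it.
  set A : ℂ := 8 * r p - 8 * α * v p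
  have hG : MeromorphicAt (fun z => A / 2 / (z - p) ^ 2 + F z) p := by fun_prop
  have hFa : ∀ᶠ z in 𝓝[≠] p, AnalyticAt ℂ F z := hF.eventually_analyticAt
  have hS : AnalyticAt ℂ (fun z => (z - p) * (deriv (deriv (deriv r)) z + 4 * v z * deriv r z
      + 2 * deriv v z * r z) - 8 * α * k z + 2 * α * l z + 8 * m z) p := by fun_prop
  obtain ⟨H, hH, hGH⟩ := exists_eq_div_pow_of_deriv (m := 0) hG hS (by
    filter_upwards [hFa, h, hu, hfr, f1, f3, u1, eventually_mem_nhdsWithin,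
      nhdsWithin_le_nhds hvk, nhdsWithin_le_nhds hvl, nhdsWithin_le_nhds hρm]
      with z ha h hu hfr f1 f3 u1 hz hvk hvl hρm
    have h0 : z - p ≠ 0 := sub_ne_zero.2 hz
    have h1 := ((((hasDerivAt_id z).sub_const p).fun_pow 2).fun_inv
      (pow_ne_zero 2 h0)).const_mul (A / 2) |>.fun_add ha.differentiableAt.hasDerivAt
    simp only [id, ← div_eq_mul_inv] at h1
    rw [h1.deriv, h, hu, hfr, f1, f3, u1]
    rw [hv0, zero_add] at hvl
    have e1 : r z = r p + (z - p) ^ 2 * m z + (z - p) * deriv r z := by rw [← hρm]; ring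
    have e2 : A = 8 * (r z - (z - p) * deriv r z - (z - p) ^ 2 * m z)
        - 8 * α * (v z - (z - p) ^ 2 * k z) := by
      simp only [A]; rw [hvk, e1]; ring
    rw [e2, hvl]
    push_cast
    field_simp
    ring)
  refine ⟨-(A / 2), H, hH, ?_⟩
  filter_upwards [hGH] with z hz
  rw [pow_zero, div_one] at hz
  rw [← hz]
  ring

/-- The logarithmic derivative of `(z - p) ^ s K` when `K' (p) = 0`, and the potential. -/
theorem exists_potential_eq {g K : ℂ → ℂ} {p : ℂ} (s : ℤ) (hK : AnalyticAt ℂ K p) (h0 : K p ≠ 0)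
    (h1 : deriv K p = 0) (hg : g =ᶠ[𝓝[≠] p] fun z => (z - p) ^ s * K z) :
    ∃ T, AnalyticAt ℂ T p ∧ potential g =ᶠ[𝓝[≠] p] fun z =>
      (-(s : ℂ) / (z - p) ^ 2 + T z + (z - p) * deriv T z) / 2
        - (s / (z - p) + (z - p) * T z) ^ 2 / 4 := by
  obtain ⟨l, hl, hKl⟩ := exists_eq_add_mul hK.deriv
  rw [h1] at hKl
  have hT : AnalyticAt ℂ (fun z => l z / K z) p := hl.fun_div hK h0
  set T := fun z => l z / K z
  have hK1 : ∀ᶠ z in 𝓝 p, deriv K z = (z - p) * T z * K z := by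
    filter_upwards [hKl, hK.continuousAt.eventually_ne h0] with z hz h0
    simp only [T]
    rw [hz]; field_simp; simp
  -- The potential is `a'/2 - a²/4` in terms of `a = g'/g`; here `a = s/(z-p) + (z-p)T`, without
  -- constant term since `K'(p) = 0`.
  have g1 : deriv g =ᶠ[𝓝[≠] p] fun z => (s / (z - p) + (z - p) * T z) * g z := by
    filter_upwards [hg.nhdsNE_deriv, hg, eventually_mem_nhdsWithin,
      nhdsWithin_le_nhds hK.eventually_analyticAt, nhdsWithin_le_nhds hK1] with z h hg hz hKz hK1
    have hzp : z - p ≠ 0 := sub_ne_zero.2 hz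
    have hd := ((hasDerivAt_zpow s (z - p) (.inl hzp)).comp z ((hasDerivAt_id z).sub_const p)).mul
      hKz.differentiableAt.hasDerivAt
    rw [h, hg, show (fun z => (z - p) ^ s * K z) = ((fun x => x ^ s) ∘ fun x => id x - p) * K from
      rfl, hd.deriv, hK1, zpow_sub_one₀ hzp]
    simp only [id, Function.comp]
    field_simp
  refine ⟨T, hT, ?_⟩
  have hgne : ∀ᶠ z in 𝓝[≠] p, g z ≠ 0 := by
    filter_upwards [hg, eventually_mem_nhdsWithin,
      nhdsWithin_le_nhds (hK.continuousAt.eventually_ne h0)] with z hg hz hK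
    rw [hg]
    exact mul_ne_zero (zpow_ne_zero _ (sub_ne_zero.2 hz)) hK
  have hga : ∀ᶠ z in 𝓝[≠] p, AnalyticAt ℂ g z := by
    have : MeromorphicAt g p := by
      refine MeromorphicAt.congr ?_ hg.symm
      fun_prop
    exact this.eventually_analyticAt
  filter_upwards [g1, g1.nhdsNE_deriv, hgne, hga, eventually_mem_nhdsWithin,
    nhdsWithin_le_nhds hT.eventually_analyticAt] with z g1 g2 hgz hga hz hTz
  have hzp : z - p ≠ 0 := sub_ne_zero.2 hz
  have hd := (((((hasDerivAt_id z).sub_const p).fun_inv hzp).const_mul (s : ℂ)).fun_add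
    (((hasDerivAt_id z).sub_const p).fun_mul hTz.differentiableAt.hasDerivAt)).fun_mul
    hga.differentiableAt.hasDerivAt
  simp only [id, ← div_eq_mul_inv] at hd
  have e2 : iteratedDeriv 2 g z = deriv (deriv g) z := by
    rw [iteratedDeriv_succ, iteratedDeriv_one]
  rw [potential, e2, g2, hd.deriv, g1]
  field_simp
  ring

theorem deriv_kdvFun_succ (n : ℕ) {g : ℂ → ℂ} {z : ℂ} (ha : AnalyticAt ℂ g z) (h0 : g z ≠ 0) :
    deriv (kdvFun (n + 1) g) z = deriv (deriv (deriv (kdvFun n g))) z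
      + 4 * potential g z * deriv (kdvFun n g) z + 2 * deriv (potential g) z * kdvFun n g z := by
  have hu := isRationalFunctional_potential.analyticAt ha h0
  have key (P : DiffPoly) :
      deriv (evalDiff P (potential g)) =ᶠ[𝓝 z] evalDiff (dz P) (potential g) :=
    hu.eventually_analyticAt.mono fun y hy => (hasDerivAt_evalDiff P hy).deriv
  have k1 := key (kdvP n)
  have k2 := k1.deriv.trans (key _)
  have k3 := k2.deriv.trans (key _)
  have e : kdvFun n g = evalDiff (kdvP n) (potential g) := rfl
  rw [e, k3.self_of_nhds, k1.self_of_nhds, kdvFun, (key _).self_of_nhds, dz_kdvP_succ,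
    evalDiff_lawOp]

/-! ### The regular set of a meromorphic function in normal form -/

namespace IsCylMeromorphic

variable {g : ℂ → ℂ} (hg : IsCylMeromorphic g)
include hg

theorem meromorphicAt (z : ℂ) : MeromorphicAt g z := (hg.normalForm (Set.mem_univ z)).meromorphicAt

/-- A normal form takes the value `0` at its poles as well as at its zeros, so one inequality
detects both. -/
theorem mem_regularSet_iff {z : ℂ} : z ∈ regularSet g ↔ g z ≠ 0 :=
  (hg.normalForm (Set.mem_univ z)).meromorphicOrderAt_eq_zero_iff

theorem analyticAt_of_order_nonneg {z : ℂ} (h : 0 ≤ meromorphicOrderAt g z) : AnalyticAt ℂ g z :=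
  (hg.normalForm (Set.mem_univ z)).meromorphicOrderAt_nonneg_iff_analyticAt.1 h

theorem analyticAt {z : ℂ} (h : z ∈ regularSet g) : AnalyticAt ℂ g z :=
  hg.analyticAt_of_order_nonneg (le_of_eq (Eq.symm h))

theorem eventually_mem_regularSet {z : ℂ} (h : z ∈ regularSet g) :
    ∀ᶠ y in 𝓝 z, y ∈ regularSet g :=
  ((hg.analyticAt h).continuousAt.eventually_ne (hg.mem_regularSet_iff.1 h)).mono
    fun _ hy => hg.mem_regularSet_iff.2 hy

theorem isOpen_regularSet : IsOpen (regularSet g) :=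
  isOpen_iff_mem_nhds.2 fun _ hz => hg.eventually_mem_regularSet hz

theorem eventually_nhdsNE_mem_regularSet {p : ℂ} (h : meromorphicOrderAt g p ≠ ⊤) :
    ∀ᶠ z in 𝓝[≠] p, z ∈ regularSet g :=
  ((meromorphicOrderAt_ne_top_iff_eventually_ne_zero (hg.meromorphicAt p)).1 h).mono
    fun _ hz => hg.mem_regularSet_iff.2 hz

end IsCylMeromorphic

theorem IsRationalFunctional.meromorphicAt {Φ : (ℂ → ℂ) → ℂ → ℂ} (hΦ : IsRationalFunctional Φ)
    {g : ℂ → ℂ} {p : ℂ} (hg : MeromorphicAt g p)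
    (h : ∀ᶠ z in 𝓝[≠] p, AnalyticAt ℂ g z ∧ g z ≠ 0) : MeromorphicAt (Φ g) p := by
  obtain ⟨q, m, hq⟩ := hΦ
  refine ((meromorphicAt_evalDiff q hg).div (hg.pow m)).congr ?_
  filter_upwards [h] with z hz
  exact (hq g z hz.1 hz.2).symm

/-! ### Behaviour at residue-free double zeros and double poles -/

section DoubleZero

variable {g E : ℂ → ℂ} {p : ℂ} (hE : AnalyticAt ℂ E p) (hE0 : E p ≠ 0) (hE1 : deriv E p = 0)
  (hg : MeromorphicAt g p) (hreg : ∀ᶠ z in 𝓝[≠] p, AnalyticAt ℂ g z ∧ g z ≠ 0)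
include hE hE0 hE1

theorem deriv_inv_eq_zero : deriv (fun z => (E z)⁻¹) p = 0 := by
  rw [(hE.differentiableAt.hasDerivAt.fun_inv hE0).deriv, hE1]; simp

/-- For exponent `s = 2` the potential is `-2/(z-p)² - T/2 + (z-p)T'/2 - (z-p)²T²/4`. The linear
terms of the second and third summands cancel, which is the trivial monodromy condition `v'(p) = 0`
needed by the KdV recurrence. -/
theorem potential_at_double_zero (h : (fun z => (g z)⁻¹) =ᶠ[𝓝[≠] p] fun z => E z / (z - p) ^ 2) :
    ∃ v, AnalyticAt ℂ v p ∧ deriv v p = 0 ∧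
      potential g =ᶠ[𝓝[≠] p] fun z => -2 / (z - p) ^ 2 + v z := by
  obtain ⟨T, hT, hu⟩ := exists_potential_eq (g := g) 2 (hE.fun_inv hE0) (inv_ne_zero hE0)
    (deriv_inv_eq_zero hE hE0 hE1) (by
      filter_upwards [h] with z hz
      rw [← inv_inv (g z), hz, inv_div, div_eq_mul_inv]
      norm_cast)
  refine ⟨fun z => -T p / 2 + (-(T z - T p) / 2 + (z - p) * deriv T z / 2
    - (z - p) ^ 2 * T z ^ 2 / 4), by fun_prop, ?_, ?_⟩
  · have h1 := (((((hT.differentiableAt.hasDerivAt.sub_const (T p)).fun_neg.div_const 2).fun_add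
      ((((hasDerivAt_id p).sub_const p).fun_mul
        hT.deriv.differentiableAt.hasDerivAt).div_const 2)).fun_sub
      (((((hasDerivAt_id p).sub_const p).fun_pow 2).fun_mul
        (hT.differentiableAt.hasDerivAt.fun_pow 2)).div_const 4))).const_add (-T p / 2)
    refine h1.deriv.trans ?_
    simp
    ring
  · filter_upwards [hu, eventually_mem_nhdsWithin] with z hz hzp
    have h0 : z - p ≠ 0 := sub_ne_zero.2 hzp
    rw [hz]
    push_cast
    field_simp
    ring

include hg hreg

theorem kdvFun_at_double_zero (h : (fun z => (g z)⁻¹) =ᶠ[𝓝[≠] p] fun z => E z / (z - p) ^ 2)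
    (n : ℕ) : HasResidueFreeDoublePole (kdvFun n g) p := by
  obtain ⟨v, hv, hv0, hu⟩ := potential_at_double_zero hE hE0 hE1 h
  induction n with
  | zero =>
    refine ⟨0, fun _ => 1 / 2, analyticAt_const, .of_forall fun z => ?_⟩
    rw [kdvFun_apply, kdvP_zero, evalDiff_C]
    simp
  | succ n ih =>
    exact ih.of_recurrence hv hv0 hu ((isRationalFunctional_kdvFun (n + 1)).meromorphicAt hg hreg)
      (hreg.mono fun z hz => deriv_kdvFun_succ n hz.1 hz.2)

/-- Write `x = z - p`, `P = α/x² + r` and `1/g = E/x²` with `E'(p) = 0`. Integrating `4P(1/g)'`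
gives `h = 2αE(p)/x⁴ + H/x²` with `H` holomorphic. Hence `2gh` has principal part `4α/x²`, which
cancels that of `-4P`, and `g²h` is holomorphic. Moreover `gP = (α + x²r)/E` is critical at `p`,
which makes the flow vanish there. -/
theorem expansions_at_double_zero
    (h : (fun z => (g z)⁻¹) =ᶠ[𝓝[≠] p] fun z => E z / (z - p) ^ 2) (n : ℕ) :
    (∃ b, AnalyticAt ℂ b p ∧
      (fun z => -4 * kdvFun n g z + 2 * g z * kdvPrimitive n g z) =ᶠ[𝓝[≠] p] b) ∧
    (∃ k, AnalyticAt ℂ k p ∧ (fun z => g z ^ 2 * kdvPrimitive n g z) =ᶠ[𝓝[≠] p] k) ∧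
    ∃ q, AnalyticAt ℂ q p ∧ deriv q p = 0 ∧ (fun z => g z * kdvFun n g z) =ᶠ[𝓝[≠] p] q := by
  obtain ⟨α, r, hr, hP⟩ := kdvFun_at_double_zero hE hE0 hE1 hg hreg h n
  obtain ⟨R, hR, hER⟩ := exists_eq_add_sq_mul hE hE1
  have hne : ∀ᶠ z in 𝓝[≠] p, z - p ≠ 0 :=
    eventually_mem_nhdsWithin.mono fun z hz => sub_ne_zero.2 hz
  have hEne : ∀ᶠ z in 𝓝[≠] p, E z ≠ 0 :=
    nhdsWithin_le_nhds (hE.continuousAt.eventually_ne hE0)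
  have hw : (fun z => (g z)⁻¹) =ᶠ[𝓝[≠] p] fun z => E p / (z - p) ^ 2 + R z := by
    filter_upwards [h, nhdsWithin_le_nhds hER, hne] with z hz hER h0
    rw [hz, hER]; field_simp
  have hg' : g =ᶠ[𝓝[≠] p] fun z => (z - p) ^ 2 / E z := by
    filter_upwards [h] with z hz
    rw [← inv_inv (g z), hz, inv_div]
  have hw1 := deriv_div_pow_add hR hw
  have hh := (isRationalFunctional_kdvPrimitive n).meromorphicAt hg hreg
  obtain ⟨H, hH, hhH⟩ := exists_eq_div_pow_of_deriv (m := 2) (p := p)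
    (F := fun z => -(2 * α * E p) / (z - p) ^ 4 + kdvPrimitive n g z)
    (S := fun z => 4 * α * (z - p) * deriv R z - 8 * E p * r z + 4 * (z - p) ^ 3 * r z * deriv R z)
    (by fun_prop) (by fun_prop) (by
      filter_upwards [hreg, hw1, hP, hne] with z hz hw1 hP h0
      have hd := (hasDerivAt_kdvPrimitive n hz.1 hz.2)
      have h1 := ((((hasDerivAt_id z).sub_const p).fun_pow 4).fun_inv
        (pow_ne_zero 4 h0)).const_mul (-(2 * α * E p)) |>.fun_add hd
      simp only [id, ← div_eq_mul_inv] at h1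
      have hi := (hz.1.differentiableAt.hasDerivAt.fun_inv hz.2).deriv
      rw [hi] at hw1
      have e : -4 * kdvFun n g z * deriv g z / g z ^ 2
          = 4 * kdvFun n g z * (-deriv g z / g z ^ 2) := by ring
      rw [h1.deriv, e, hw1, hP]
      push_cast
      field_simp
      ring)
  refine ⟨⟨fun z => -4 * α * R z / E z + 2 * H z / E z - 4 * r z, ?_, ?_⟩,
    ⟨fun z => (2 * α * E p + (z - p) ^ 2 * H z) / E z ^ 2, ?_, ?_⟩,
    ⟨fun z => (α + (z - p) ^ 2 * r z) * (E z)⁻¹, ?_, ?_, ?_⟩⟩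
  · fun_prop (disch := exact hE0)
  · filter_upwards [hhH, hP, hg', hne, hEne, nhdsWithin_le_nhds hER] with z hhH hP hg' h0 hE' hER
    have e : kdvPrimitive n g z = 2 * α * E p / (z - p) ^ 4 + H z / (z - p) ^ 2 := by
      rw [← hhH]; ring
    have e2 : E p = E z - (z - p) ^ 2 * R z := by rw [hER]; ring
    rw [e, hP, hg', e2]
    field_simp
    ring
  · fun_prop (disch := exact pow_ne_zero 2 hE0)
  · filter_upwards [hhH, hg', hne, hEne] with z hhH hg' h0 hE'
    have e : kdvPrimitive n g z = 2 * α * E p / (z - p) ^ 4 + H z / (z - p) ^ 2 := by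
      rw [← hhH]; ring
    rw [e, hg']
    field_simp
  · fun_prop (disch := exact hE0)
  · have h1 := ((((((hasDerivAt_id p).sub_const p).fun_pow 2).fun_mul
      hr.differentiableAt.hasDerivAt)).const_add α).fun_mul
      (hE.differentiableAt.hasDerivAt.fun_inv hE0)
    refine h1.deriv.trans ?_
    simp [hE1]
  · filter_upwards [hP, hg', hne] with z hP hg' h0
    rw [hP, hg']
    field_simp

end DoubleZero

/-- For exponent `s = -2` the double pole of the potential cancels (`2/2 - 4/4 = 0`), and there is
no simple pole as `K'(p) = 0`. So `u` is holomorphic, hence so are `P_n(u)` and `h' =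
4P_n(u)(1/g)'`. -/
theorem expansions_at_double_pole {g K : ℂ → ℂ} {p : ℂ} (hK : AnalyticAt ℂ K p) (hK0 : K p ≠ 0)
    (hK1 : deriv K p = 0) (hg : MeromorphicAt g p)
    (hreg : ∀ᶠ z in 𝓝[≠] p, AnalyticAt ℂ g z ∧ g z ≠ 0)
    (h : g =ᶠ[𝓝[≠] p] fun z => K z / (z - p) ^ 2) (n : ℕ) :
    (∃ P, AnalyticAt ℂ P p ∧ kdvFun n g =ᶠ[𝓝[≠] p] P) ∧
    ∃ H, AnalyticAt ℂ H p ∧ kdvPrimitive n g =ᶠ[𝓝[≠] p] H := by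
  have hne : ∀ᶠ z in 𝓝[≠] p, z - p ≠ 0 :=
    eventually_mem_nhdsWithin.mono fun z hz => sub_ne_zero.2 hz
  obtain ⟨T, hT, hu⟩ := exists_potential_eq (g := g) (-2) hK hK0 hK1 (by
    filter_upwards [h] with z hz
    rw [hz, zpow_neg, div_eq_inv_mul]
    norm_cast)
  have hu' : potential g =ᶠ[𝓝[≠] p] fun z => 3 * T z / 2 + (z - p) * deriv T z / 2
      - (z - p) ^ 2 * T z ^ 2 / 4 := by
    filter_upwards [hu, hne] with z hz h0
    rw [hz]
    push_cast
    field_simp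
    ring
  have hv : AnalyticAt ℂ (fun z => 3 * T z / 2 + (z - p) * deriv T z / 2
      - (z - p) ^ 2 * T z ^ 2 / 4) p := by fun_prop
  have hP := evalDiff_congr_of_eventuallyEq_nhdsNE hu' (kdvP n)
  have hPa := analyticAt_evalDiff (kdvP n) hv
  refine ⟨⟨_, hPa, hP⟩, ?_⟩
  have hw : (fun z => (g z)⁻¹) =ᶠ[𝓝[≠] p] fun z => (z - p) ^ 2 / K z := by
    filter_upwards [h] with z hz
    rw [hz, inv_div]
  have hwa : AnalyticAt ℂ (fun z => (z - p) ^ 2 / K z) p := by fun_prop (disch := exact hK0)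
  set P := evalDiff (kdvP n) fun z => 3 * T z / 2 + (z - p) * deriv T z / 2
      - (z - p) ^ 2 * T z ^ 2 / 4
  obtain ⟨H, hH, hhH⟩ := exists_eq_div_pow_of_deriv (m := 0)
    (S := fun z => (z - p) * (4 * P z * deriv (fun z => (z - p) ^ 2 / K z) z))
    ((isRationalFunctional_kdvPrimitive n).meromorphicAt hg hreg) (by
      have := hwa.deriv
      fun_prop) (by
      filter_upwards [hreg, hP, hw.nhdsNE_deriv, hne] with z hz hP hw h0
      rw [(hz.1.differentiableAt.hasDerivAt.fun_inv hz.2).deriv] at hw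
      rw [(hasDerivAt_kdvPrimitive n hz.1 hz.2).deriv, kdvFun_apply, hP, ← hw]
      field_simp
      ring)
  refine ⟨H, hH, ?_⟩
  filter_upwards [hhH] with z hz
  rw [hz, pow_zero, div_one]

/-! ### Smooth extension through isolated points -/

theorem contDiffAt_conj_comp {φ : ℂ → ℂ} {z : ℂ} (h : ContDiffAt ℝ ∞ φ z) :
    ContDiffAt ℝ ∞ (fun y => starRingEnd ℂ (φ y)) z :=
  conjCLE.contDiff.contDiffAt.comp z h

theorem one_add_mul_conj_ne_zero (a : ℂ) : 1 + a * starRingEnd ℂ a ≠ 0 := by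
  rw [mul_conj]
  have : (0 : ℝ) < 1 + normSq a := by have := normSq_nonneg a; linarith
  exact_mod_cast this.ne'

theorem _root_.AnalyticAt.contDiffAt_real {φ : ℂ → ℂ} {z : ℂ} (h : AnalyticAt ℂ φ z) :
    ContDiffAt ℝ ∞ φ z :=
  h.contDiffAt.restrict_scalars ℝ

/-- The local extensions glue to the diagonal `z ↦ s z z`: near `p` both `s z` and `s p` are
continuous at `z` and agree with `J` on a punctured neighbourhood of `z`, so their values at `z`
coincide. -/
theorem exists_contDiff_extension {J : ℂ → ℂ}
    (h : ∀ p, ∃ s, ContDiffAt ℝ ∞ s p ∧ J =ᶠ[𝓝[≠] p] s) :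
    ∃ f : ℂ → ℂ, ContDiff ℝ ∞ f ∧ ∀ p, J =ᶠ[𝓝[≠] p] f := by
  choose s hs hJ using h
  have key (p : ℂ) : (fun z => s z z) =ᶠ[𝓝 p] s p := by
    have hc : ∀ᶠ z in 𝓝 p, ContinuousAt (s p) z := by
      have h1 : ContDiffAt ℝ 1 (s p) p := (hs p).of_le (by exact_mod_cast le_top)
      exact (h1.eventually (by simp)).mono fun z hz => hz.continuousAt
    have hJ' := eventually_nhdsWithin_iff.1 (eventually_nhdsNE_eventually_nhds_iff.2 (hJ p))
    filter_upwards [hc, hJ'] with z hz hJz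
    by_cases hzp : z = p
    · rw [hzp]
    · have h2 : J =ᶠ[𝓝 z] s p := hJz hzp
      have h4 : s z =ᶠ[𝓝[≠] z] s p := (hJ z).symm.trans (h2.filter_mono nhdsWithin_le_nhds)
      exact ((ContinuousAt.eventuallyEq_nhds_iff_eventuallyEq_nhdsNE
        (hs z).continuousAt hz).1 h4).eq_of_nhds
  refine ⟨fun z => s z z, contDiff_iff_contDiffAt.2 fun p => (hs p).congr_of_eventuallyEq (key p),
    fun p => (hJ p).trans ((key p).symm.filter_mono nhdsWithin_le_nhds)⟩


/-- The function `f(h)` in terms of `P_n(u)`: `g² h' / g' = -4 P_n(u)`. -/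
def jacobiFun (n : ℕ) (g : ℂ → ℂ) (z : ℂ) : ℂ :=
  -4 * kdvFun n g z + 2 * g z * kdvPrimitive n g z / (1 + g z * starRingEnd ℂ (g z))

theorem contDiffAt_one_add_mul_conj_inv {φ : ℂ → ℂ} {z : ℂ} (h : AnalyticAt ℂ φ z) :
    ContDiffAt ℝ ∞ (fun y => (1 + φ y * starRingEnd ℂ (φ y))⁻¹) z :=
  (contDiffAt_const.add (h.contDiffAt_real.mul (contDiffAt_conj_comp h.contDiffAt_real))).inv
    (one_add_mul_conj_ne_zero _)

theorem contDiffAt_jacobiFun (n : ℕ) {g : ℂ → ℂ} {z : ℂ} (ha : AnalyticAt ℂ g z) (h0 : g z ≠ 0) :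
    ContDiffAt ℝ ∞ (jacobiFun n g) z := by
  have hP := (isRationalFunctional_kdvFun n).analyticAt ha h0
  have hh := (isRationalFunctional_kdvPrimitive n).analyticAt ha h0
  have h1 : AnalyticAt ℂ (fun y => -4 * kdvFun n g y) z := by fun_prop
  have h2 : AnalyticAt ℂ (fun y => 2 * g y * kdvPrimitive n g y) z := by fun_prop
  exact h1.contDiffAt_real.add (h2.contDiffAt_real.mul (contDiffAt_one_add_mul_conj_inv ha))

/-! ### Singularities of `f(h)` and of the flow for `g` in `M_imm` -/

namespace MemMimm

variable {g : ℂ → ℂ} (hg : MemMimm g)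
include hg

theorem eventually_regular (p : ℂ) : ∀ᶠ z in 𝓝[≠] p, AnalyticAt ℂ g z ∧ g z ≠ 0 := by
  have hp : meromorphicOrderAt g p ≠ ⊤ := by
    rcases hg.order p with h | h | h <;> rw [h] <;> decide
  exact (hg.eventually_nhdsNE_mem_regularSet hp).mono fun z hz =>
    ⟨hg.analyticAt hz, hg.mem_regularSet_iff.1 hz⟩

theorem meromorphicAt_kdvFun (n : ℕ) (p : ℂ) : MeromorphicAt (kdvFun n g) p :=
  (isRationalFunctional_kdvFun n).meromorphicAt (hg.meromorphicAt p) (hg.eventually_regular p)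

theorem meromorphicAt_kdvPrimitive (n : ℕ) (p : ℂ) : MeromorphicAt (kdvPrimitive n g) p :=
  (isRationalFunctional_kdvPrimitive n).meromorphicAt (hg.meromorphicAt p)
    (hg.eventually_regular p)

theorem expansions_at_zero {p : ℂ} (hp : meromorphicOrderAt g p = 2) (n : ℕ) :
    (∃ b, AnalyticAt ℂ b p ∧
      (fun z => -4 * kdvFun n g z + 2 * g z * kdvPrimitive n g z) =ᶠ[𝓝[≠] p] b) ∧
    (∃ k, AnalyticAt ℂ k p ∧ (fun z => g z ^ 2 * kdvPrimitive n g z) =ᶠ[𝓝[≠] p] k) ∧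
    ∃ q, AnalyticAt ℂ q p ∧ deriv q p = 0 ∧ (fun z => g z * kdvFun n g z) =ᶠ[𝓝[≠] p] q := by
  have hi : MeromorphicAt (fun z => (g z)⁻¹) p := (hg.meromorphicAt p).inv
  have ho : meromorphicOrderAt (fun z => (g z)⁻¹) p = -2 := by
    rw [show (fun z => (g z)⁻¹) = g⁻¹ from rfl, meromorphicOrderAt_inv, hp]
  obtain ⟨E, hE, hE0, hE1, h⟩ := exists_eq_div_sq_of_hasResidue_zero hi ho (hg.residue_zero p hp)
  exact expansions_at_double_zero hE hE0 hE1 (hg.meromorphicAt p) (hg.eventually_regular p) h n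

theorem expansions_at_pole {p : ℂ} (hp : meromorphicOrderAt g p = -2) (n : ℕ) :
    (∃ P, AnalyticAt ℂ P p ∧ kdvFun n g =ᶠ[𝓝[≠] p] P) ∧
    ∃ H, AnalyticAt ℂ H p ∧ kdvPrimitive n g =ᶠ[𝓝[≠] p] H := by
  obtain ⟨K, hK, hK0, hK1, h⟩ :=
    exists_eq_div_sq_of_hasResidue_zero (hg.meromorphicAt p) hp (hg.residue_pole p hp)
  exact expansions_at_double_pole hK hK0 hK1 (hg.meromorphicAt p) (hg.eventually_regular p) h n

/-- Near a zero, `f = (-4P + 2gh) - 2(g²h)·ḡ/(1+|g|²)`. Near a pole, with `W = 1/g`, `f = -4P +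
2h·W̄/(1+|W|²)`. All factors are smooth by the local expansions. -/
theorem exists_smooth_jacobiFun (n : ℕ) (p : ℂ) :
    ∃ s, ContDiffAt ℝ ∞ s p ∧ jacobiFun n g =ᶠ[𝓝[≠] p] s := by
  rcases hg.order p with h | h | h
  · exact ⟨_, contDiffAt_jacobiFun n (hg.analyticAt h) (hg.mem_regularSet_iff.1 h), .rfl⟩
  · obtain ⟨⟨b, hb, hb'⟩, ⟨k, hk, hk'⟩, -⟩ := hg.expansions_at_zero h n
    have hga : AnalyticAt ℂ g p := hg.analyticAt_of_order_nonneg (by rw [h]; decide)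
    refine ⟨fun z => b z - 2 * k z * starRingEnd ℂ (g z) * (1 + g z * starRingEnd ℂ (g z))⁻¹,
      hb.contDiffAt_real.sub (((contDiffAt_const.mul hk.contDiffAt_real).mul
        (contDiffAt_conj_comp hga.contDiffAt_real)).mul (contDiffAt_one_add_mul_conj_inv hga)), ?_⟩
    filter_upwards [hb', hk'] with z hb hk
    rw [← hb, ← hk, jacobiFun]
    have := one_add_mul_conj_ne_zero (g z)
    field_simp
    ring
  · obtain ⟨⟨P, hP, hP'⟩, ⟨H, hH, hH'⟩⟩ := hg.expansions_at_pole h n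
    have ho : 0 ≤ meromorphicOrderAt g⁻¹ p := by
      rw [meromorphicOrderAt_inv, h]
      decide
    obtain ⟨W, hW, hW'⟩ := ((hg.meromorphicAt p).inv.meromorphicOrderAt_nonneg_iff).1 ho
    refine ⟨fun z => -4 * P z + 2 * H z * starRingEnd ℂ (W z) *
      (1 + W z * starRingEnd ℂ (W z))⁻¹, (contDiffAt_const.mul hP.contDiffAt_real).add
        (((contDiffAt_const.mul hH.contDiffAt_real).mul
        (contDiffAt_conj_comp hW.contDiffAt_real)).mul (contDiffAt_one_add_mul_conj_inv hW)), ?_⟩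
    filter_upwards [hP', hH', hW', hg.eventually_regular p] with z hP hH hW hz
    have h1 := one_add_mul_conj_ne_zero (g z)
    have h2 := one_add_mul_conj_ne_zero (g z)⁻¹
    have h3 : starRingEnd ℂ (g z) ≠ 0 := (map_ne_zero _).2 hz.2
    rw [← hP, ← hH, ← hW, jacobiFun]
    simp only [Pi.inv_apply, map_inv₀] at h2 ⊢
    have h4 := hz.2
    have h5 : g z * starRingEnd ℂ (g z) + 1 ≠ 0 := by rwa [add_comm]
    field_simp
    ring

/-- The flows of the Shiffman hierarchy are tangent to `W`. -/
theorem memTangent_shiffmanFlow (n : ℕ) : MemTangent g (shiffmanFlow g n) := by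
  have hmul (p : ℂ) : MeromorphicAt (fun z => g z * kdvFun n g z) p :=
    (hg.meromorphicAt p).mul (hg.meromorphicAt_kdvFun n p)
  have hF : shiffmanFlow g n = fun z => -2 * deriv (fun w => g w * kdvFun n g w) z := rfl
  have hmer (p : ℂ) : MeromorphicAt (shiffmanFlow g n) p := by
    have := (hmul p).deriv
    rw [hF]
    fun_prop
  have hper (z : ℂ) : g (z + I) * kdvFun n g (z + I) = g z * kdvFun n g z := by
    rw [hg.periodic, kdvFun, evalDiff_periodic (potential_periodic hg.periodic)]
  refine ⟨fun p => hmer p, fun z => ?_, fun p hp => ?_, fun p hp => ?_, fun z hz => ?_⟩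
  · rw [hF]
    simp only [deriv_periodic (u := fun w => g w * kdvFun n g w) hper]
  · obtain ⟨-, -, q, hq, hq0, hq'⟩ := hg.expansions_at_zero hp n
    obtain ⟨l, hl, hql⟩ := exists_eq_add_mul hq.deriv
    -- The flow is `-2q'` with `q = gP`, and `q'(p) = 0` splits off one factor `z - p`.
    have h1 : shiffmanFlow g n =ᶠ[𝓝[≠] p] (fun z => (z - p) ^ 1) * fun z => -2 * l z := by
      filter_upwards [hq'.nhdsNE_deriv, nhdsWithin_le_nhds hql] with z h1 h2
      simp only [hF, h1, h2, hq0, Pi.mul_apply]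
      ring
    have h2 : AnalyticAt ℂ (fun z => -2 * l z) p := by fun_prop
    rw [meromorphicOrderAt_congr h1, meromorphicOrderAt_mul (by fun_prop) h2.meromorphicAt,
      fun_meromorphicOrderAt_pow_id_sub_const]
    exact le_add_of_nonneg_right h2.meromorphicOrderAt_nonneg
  · obtain ⟨⟨P, hP, hP'⟩, -⟩ := hg.expansions_at_pole hp n
    obtain ⟨K, hK, -, -, h⟩ :=
      exists_eq_div_sq_of_hasResidue_zero (hg.meromorphicAt p) hp (hg.residue_pole p hp)
    have h1 : (fun w => g w * kdvFun n g w) =ᶠ[𝓝[≠] p] fun z => K z * P z / (z - p) ^ 2 := by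
      filter_upwards [hP', h] with z h1 h2
      rw [h1, h2]; ring
    have h2 : shiffmanFlow g n =ᶠ[𝓝[≠] p] (fun z => (z - p) ^ (-3 : ℤ)) * fun z =>
        -2 * ((z - p) * deriv (fun z => K z * P z) z - 2 * (K z * P z)) := by
      filter_upwards [h1.nhdsNE_deriv, eventually_mem_nhdsWithin,
        nhdsWithin_le_nhds (hK.mul hP).eventually_analyticAt] with z h1 hz ha
      have h0 : z - p ≠ 0 := sub_ne_zero.2 hz
      have hd := (show HasDerivAt (fun z => K z * P z) _ z from
        ha.differentiableAt.hasDerivAt).fun_div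
        (((hasDerivAt_id z).sub_const p).fun_pow 2) (pow_ne_zero 2 h0)
      simp only [id] at hd
      simp only [hF, h1, hd.deriv, Pi.mul_apply, zpow_neg]
      norm_cast
      have e : deriv (K * P) z = deriv (fun z => K z * P z) z := rfl
      rw [e]
      field_simp
      ring
    have h3 : AnalyticAt ℂ (fun z => -2 * ((z - p) * deriv (fun z => K z * P z) z
        - 2 * (K z * P z))) p := by
      have := (hK.fun_mul hP).deriv
      fun_prop
    rw [meromorphicOrderAt_congr h2, meromorphicOrderAt_mul (by fun_prop) h3.meromorphicAt,
      fun_meromorphicOrderAt_zpow_id_sub_const]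
    exact le_add_of_nonneg_right h3.meromorphicOrderAt_nonneg
  · have ha := hg.analyticAt hz
    have h1 := (ha.fun_mul ((isRationalFunctional_kdvFun n).analyticAt ha
      (hg.mem_regularSet_iff.1 hz))).deriv
    have : AnalyticAt ℂ (shiffmanFlow g n) z := by
      rw [hF]
      fun_prop
    exact this.meromorphicOrderAt_nonneg

/-- The normal form of the primitive of `4 P_n(u) (1/g)'`. -/
theorem exists_cylMeromorphic_primitive (n : ℕ) : ∃ h, IsCylMeromorphic h ∧
    ∀ z ∈ regularSet g, h =ᶠ[𝓝 z] kdvPrimitive n g := by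
  have hm : MeromorphicOn (kdvPrimitive n g) Set.univ := fun p _ => hg.meromorphicAt_kdvPrimitive n p
  set h := toMeromorphicNFOn (kdvPrimitive n g) Set.univ
  have hN : MeromorphicNFOn h Set.univ := meromorphicNFOn_toMeromorphicNFOn _ _
  have he (z : ℂ) : kdvPrimitive n g =ᶠ[𝓝[≠] z] h :=
    (hm.toMeromorphicNFOn_eq_self_on_nhdsNE (Set.mem_univ z)).symm
  have hp := kdvPrimitive_periodic hg.periodic n
  refine ⟨h, ⟨hN, fun z => ?_⟩, fun z hz => ?_⟩
  -- Passing to the normal form may change values at singular points, so periodicity is recovered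
  -- from the fact that normal forms agreeing on a punctured neighbourhood agree at its centre.
  · have hN' : MeromorphicNFAt (fun y => h (y + I)) z :=
      (meromorphicNFAt_comp_add_const_iff_meromorphicNFAt (f := h)).2 (hN (Set.mem_univ _))
    have ht : Tendsto (fun y => y + I) (𝓝[≠] z) (𝓝[≠] (z + I)) := by
      refine tendsto_nhdsWithin_iff.2 ⟨?_, ?_⟩
      · exact ((continuous_add_const I).tendsto z).mono_left nhdsWithin_le_nhds
      · exact eventually_mem_nhdsWithin.mono fun y hy => by simpa using hy
    have h1 : (fun y => h (y + I)) =ᶠ[𝓝[≠] z] h := by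
      filter_upwards [ht.eventually (he (z + I)), he z] with y h1 h2
      rw [← h1, hp, h2]
    exact ((hN'.eventuallyEq_nhdsNE_iff_eventuallyEq_nhds (hN (Set.mem_univ z))).1 h1).eq_of_nhds
  · have ha := (isRationalFunctional_kdvPrimitive n).analyticAt (hg.analyticAt hz)
      (hg.mem_regularSet_iff.1 hz)
    exact ((hN (Set.mem_univ z)).eventuallyEq_nhdsNE_iff_eventuallyEq_nhds
      ha.meromorphicNFAt).1 (he z).symm

end MemMimm

/-! ### The Jacobi equation -/

/-- The real derivative of `φ` at `z` is `a dz + b dz̄`. -/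
def HasWirtingerDerivAt (φ : ℂ → ℂ) (a b z : ℂ) : Prop :=
  HasFDerivAt φ (a • ContinuousLinearMap.id ℝ ℂ + b • (conjCLE : ℂ →L[ℝ] ℂ)) z

namespace HasWirtingerDerivAt

variable {φ ψ : ℂ → ℂ} {a b c d z : ℂ}

theorem of_hasDerivAt (h : HasDerivAt φ a z) : HasWirtingerDerivAt φ a 0 z := by
  refine (h.hasFDerivAt.restrictScalars ℝ).congr_fderiv ?_
  ext
  simp [mul_comm]

theorem conj (h : HasWirtingerDerivAt φ a b z) :
    HasWirtingerDerivAt (fun y => starRingEnd ℂ (φ y)) (starRingEnd ℂ b) (starRingEnd ℂ a) z := by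
  refine ((conjCLE : ℂ →L[ℝ] ℂ).hasFDerivAt.comp z h).congr_fderiv ?_
  ext
  simp
  ring

theorem add (h : HasWirtingerDerivAt φ a b z) (k : HasWirtingerDerivAt ψ c d z) :
    HasWirtingerDerivAt (fun y => φ y + ψ y) (a + c) (b + d) z := by
  refine (HasFDerivAt.fun_add h k).congr_fderiv ?_
  ext
  simp
  ring

theorem mul (h : HasWirtingerDerivAt φ a b z) (k : HasWirtingerDerivAt ψ c d z) :
    HasWirtingerDerivAt (fun y => φ y * ψ y) (a * ψ z + φ z * c) (b * ψ z + φ z * d) z := by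
  refine (HasFDerivAt.mul h k).congr_fderiv ?_
  ext
  simp
  ring

theorem inv (h : HasWirtingerDerivAt φ a b z) (h0 : φ z ≠ 0) :
    HasWirtingerDerivAt (fun y => (φ y)⁻¹) (-a * (φ z)⁻¹ ^ 2) (-b * (φ z)⁻¹ ^ 2) z := by
  have h1 := (((hasDerivAt_inv h0).hasFDerivAt.restrictScalars ℝ).comp z h)
  refine (show HasFDerivAt (fun y => (φ y)⁻¹) _ z from h1).congr_fderiv ?_
  ext
  simp
  ring

theorem congr_coeff {a' b' : ℂ} (h : HasWirtingerDerivAt φ a b z) (ha : a = a') (hb : b = b') :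
    HasWirtingerDerivAt φ a' b' z := ha ▸ hb ▸ h

/-- `Δ = 2(∂_z̄ ∂_z + ∂_z ∂_z̄)`: `a₂` and `b₁` are the two mixed derivatives, kept apart so that
their symmetry is not needed. -/
theorem laplacian_eq {A B : ℂ → ℂ} {a₁ a₂ b₁ b₂ : ℂ}
    (h : ∀ᶠ y in 𝓝 z, HasWirtingerDerivAt φ (A y) (B y) y) (hA : HasWirtingerDerivAt A a₁ a₂ z)
    (hB : HasWirtingerDerivAt B b₁ b₂ z) : Laplacian.laplacian φ z = 2 * (a₂ + b₁) := by
  have h1 : fderiv ℝ φ =ᶠ[𝓝 z] fun y =>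
      A y • ContinuousLinearMap.id ℝ ℂ + B y • (conjCLE : ℂ →L[ℝ] ℂ) :=
    h.mono fun y hy => HasFDerivAt.fderiv hy
  have h2 := (HasFDerivAt.smul_const hA (ContinuousLinearMap.id ℝ ℂ)).add
    (HasFDerivAt.smul_const hB (conjCLE : ℂ →L[ℝ] ℂ))
  have h3 := (h2.congr_of_eventuallyEq h1).fderiv
  rw [InnerProductSpace.laplacian_eq_iteratedFDeriv_complexPlane]
  simp only [iteratedFDeriv_two_apply, h3]
  simp
  linear_combination (a₁ - a₂ - b₁ + b₂) * I_mul_I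

end HasWirtingerDerivAt

theorem hasWirtingerDerivAt_one_add_mul_conj_inv {g : ℂ → ℂ} {g' z : ℂ} (h : HasDerivAt g g' z) :
    HasWirtingerDerivAt (fun y => (1 + g y * starRingEnd ℂ (g y))⁻¹)
      (-(g' * starRingEnd ℂ (g z)) * (1 + g z * starRingEnd ℂ (g z))⁻¹ ^ 2)
      (-(g z * starRingEnd ℂ g') * (1 + g z * starRingEnd ℂ (g z))⁻¹ ^ 2) z := by
  have h1 := HasWirtingerDerivAt.of_hasDerivAt h
  refine (((HasWirtingerDerivAt.of_hasDerivAt (hasDerivAt_const z 1)).add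
    (h1.mul h1.conj)).inv (one_add_mul_conj_ne_zero _)).congr_coeff ?_ ?_ <;> simp

/-- With `ρ = 1 + |g|²`, the holomorphic `P` drops out of the `z̄`-derivative, leaving `f_z̄ =
-2g²h·conj(g')/ρ²`. Differentiating in `z` with `g²h' = -4Pg'` gives `-2|g'|²/ρ² · (-4P + 2gh(1 -
|g|²/ρ))`, and the last factor is `f` again because `1 - |g|²/ρ = 1/ρ`. -/
theorem laplacian_jacobiFun (n : ℕ) {g : ℂ → ℂ} {z : ℂ} (ha : AnalyticAt ℂ g z) (h0 : g z ≠ 0) :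
    Laplacian.laplacian (jacobiFun n g) z = -(8 * (deriv g z * starRingEnd ℂ (deriv g z))
      * (1 + g z * starRingEnd ℂ (g z))⁻¹ ^ 2 * jacobiFun n g z) := by
  have hPa := (isRationalFunctional_kdvFun n).analyticAt ha h0
  have hev : ∀ᶠ y in 𝓝 z, AnalyticAt ℂ g y ∧ g y ≠ 0 :=
    ha.eventually_analyticAt.and (ha.continuousAt.eventually_ne h0)
  have hc {y : ℂ} (a : ℂ) : HasWirtingerDerivAt (fun _ => a) 0 0 y :=
    .of_hasDerivAt (hasDerivAt_const y a)
  have hJ : jacobiFun n g = fun y => -4 * kdvFun n g y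
      + 2 * (g y * kdvPrimitive n g y) * (1 + g y * starRingEnd ℂ (g y))⁻¹ := by
    funext y; rw [jacobiFun]; ring
  have hw (y : ℂ) (hy : AnalyticAt ℂ g y ∧ g y ≠ 0) :
      HasWirtingerDerivAt (jacobiFun n g)
        (-4 * deriv (kdvFun n g) y
          + 2 * (deriv g y * kdvPrimitive n g y + -4 * (kdvFun n g y * deriv g y * (g y)⁻¹))
            * (1 + g y * starRingEnd ℂ (g y))⁻¹
          + -2 * (g y * kdvPrimitive n g y) * (deriv g y * starRingEnd ℂ (g y))
            * ((1 + g y * starRingEnd ℂ (g y))⁻¹ * (1 + g y * starRingEnd ℂ (g y))⁻¹))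
        (-2 * (g y * kdvPrimitive n g y) * (g y * starRingEnd ℂ (deriv g y))
          * ((1 + g y * starRingEnd ℂ (g y))⁻¹ * (1 + g y * starRingEnd ℂ (g y))⁻¹)) y := by
    have hP := ((isRationalFunctional_kdvFun n).analyticAt hy.1 hy.2).differentiableAt.hasDerivAt
    have hg' := hy.1.differentiableAt.hasDerivAt
    have hgh := HasWirtingerDerivAt.of_hasDerivAt
      (hg'.fun_mul (hasDerivAt_kdvPrimitive n hy.1 hy.2))
    rw [hJ]
    refine (((hc (-4)).mul (.of_hasDerivAt hP)).add (((hc 2).mul hgh).mul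
      (hasWirtingerDerivAt_one_add_mul_conj_inv hg'))).congr_coeff ?_ ?_
    · have := hy.2
      have hρ := one_add_mul_conj_ne_zero (g y)
      generalize starRingEnd ℂ (g y) = c at *
      field_simp
      ring
    · ring
  have hg0 := ha.differentiableAt.hasDerivAt
  have hg1 := ha.deriv.differentiableAt.hasDerivAt
  have hP0 := hPa.differentiableAt.hasDerivAt
  have hP1 := hPa.deriv.differentiableAt.hasDerivAt
  have hh := hasDerivAt_kdvPrimitive n ha h0
  have wg := HasWirtingerDerivAt.of_hasDerivAt hg0
  have wg1 := HasWirtingerDerivAt.of_hasDerivAt hg1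
  have wgh := HasWirtingerDerivAt.of_hasDerivAt (hg0.fun_mul hh)
  have wρ := hasWirtingerDerivAt_one_add_mul_conj_inv hg0
  have wd := HasWirtingerDerivAt.of_hasDerivAt ((hg1.fun_mul hh).fun_add
    (((hP0.fun_mul hg1).fun_mul (hg0.fun_inv h0)).const_mul (-4)))
  have wA := (((hc (-4)).mul (.of_hasDerivAt hP1)).add (((hc 2).mul wd).mul wρ)).add
    ((((hc (-2)).mul wgh).mul (wg1.mul wg.conj)).mul (wρ.mul wρ))
  have wB := (((hc (-2)).mul wgh).mul (wg.mul wg1.conj)).mul (wρ.mul wρ)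
  rw [HasWirtingerDerivAt.laplacian_eq (hev.mono hw) wA wB, hJ]
  have hρ := one_add_mul_conj_ne_zero (g z)
  simp only [map_zero]
  field_simp
  ring

/-- The Jacobi equation is real-linear with a real coefficient, so real-linear functionals carry
complex solutions to real ones. -/
theorem isJacobi_clm_comp {n : ℕ} {g f : ℂ → ℂ} (hg : IsCylMeromorphic g)
    (hf : ContDiff ℝ ∞ f) (hper : ∀ z, f (z + I) = f z)
    (hJ : ∀ z ∈ regularSet g, f =ᶠ[𝓝 z] jacobiFun n g) (L : ℂ →L[ℝ] ℝ) :
    IsJacobi g fun z => L (f z) := by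
  refine ⟨fun z => by rw [hper], (L.contDiff.comp hf).contDiffOn, fun z hz => ?_⟩
  have h2 : ContDiffAt ℝ 2 f z := mod_cast (contDiff_infty.1 hf 2).contDiffAt
  have h1 : Laplacian.laplacian f z
      = (-(8 * ‖deriv g z‖ ^ 2 / (1 + ‖g z‖ ^ 2) ^ 2) : ℝ) • f z := by
    rw [(InnerProductSpace.laplacian_congr_nhds (hJ z hz)).eq_of_nhds,
      laplacian_jacobiFun n (hg.analyticAt hz) (hg.mem_regularSet_iff.1 hz),
      (hJ z hz).eq_of_nhds, mul_conj', mul_conj', real_smul]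
    push_cast
    rw [inv_pow, div_eq_mul_inv]
    ring
  have h3 := h2.laplacian_CLM_comp_left (l := L)
  rw [show (fun z => L (f z)) = L ∘ f from rfl, h3, Function.comp, h1, map_smul, smul_eq_mul]
  ring

/-- For `Y = ((A+B)/2, i(A-B)/2, C)` one has `⟨Y,N⟩ = (Ag + Bḡ + C(|g|²-1))/(1+|g|²)`. Matching this
with `f` gives `A = (C - 4P)/g + 2h` and `B = -gC - 4gP`; the null condition `C' = gA'` then forces
`C = -4(gP'/g' + P)`. With these choices `Y' = A'·((1-g²)/2, i(1+g²)/2, g)`, which is orthogonal to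
`N`. -/
theorem isConjugateJacobi_re_im {n : ℕ} {g f : ℂ → ℂ} (hg : IsCylMeromorphic g)
    (hJ : ∀ z ∈ regularSet g, f =ᶠ[𝓝 z] jacobiFun n g) :
    IsConjugateJacobi g (fun z => (f z).re) fun z => (f z).im := by
  set P := kdvFun n g
  set h := kdvPrimitive n g
  set A : ℂ → ℂ := fun z => -4 * (deriv P z / deriv g z) + 2 * h z - 8 * (P z / g z)
  set B : ℂ → ℂ := fun z => 4 * (g z ^ 2 * (deriv P z / deriv g z))
  set C : ℂ → ℂ := fun z => -4 * (g z * (deriv P z / deriv g z) + P z)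
  have hPper : ∀ z, P (z + I) = P z := evalDiff_periodic (potential_periodic hg.periodic) _
  have key (z : ℂ) (hz : z ∈ unbranchedSet g) : ∃ A', HasDerivAt A A' z ∧
      HasDerivAt C (g z * A') z ∧ HasDerivAt B (-(g z * (g z * A'))) z := by
    have ha := hg.analyticAt hz.1
    have h0 := hg.mem_regularSet_iff.1 hz.1
    have hg0 := ha.differentiableAt.hasDerivAt
    have hP := (isRationalFunctional_kdvFun n).analyticAt ha h0
    have hP0 : HasDerivAt P (deriv P z) z := hP.differentiableAt.hasDerivAt
    have hπ := (hP.deriv.div ha.deriv hz.2).differentiableAt.hasDerivAt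
    set π' := deriv (deriv (kdvFun n g) / deriv g) z
    have hπ0 : HasDerivAt (fun z => deriv P z / deriv g z) π' z := hπ
    have hh : HasDerivAt h (-4 * P z * deriv g z / g z ^ 2) z := hasDerivAt_kdvPrimitive n ha h0
    have hz2 := hz.2
    refine ⟨-4 * π' - 8 * deriv P z / g z, ?_, ?_, ?_⟩
    · refine (((hπ0.const_mul (-4)).fun_add (hh.const_mul 2)).fun_sub
        ((hP0.fun_div hg0 h0).const_mul 8)).congr_deriv ?_
      field_simp
      ring
    · refine (((hg0.fun_mul hπ0).fun_add hP0).const_mul (-4)).congr_deriv ?_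
      field_simp
      ring
    · refine (((hg0.fun_pow 2).fun_mul hπ0).const_mul 4).congr_deriv ?_
      field_simp
      ring
  set Y : ℂ → Fin 3 → ℂ := fun z => ![(A z + B z) / 2, I * (A z - B z) / 2, C z]
  have hY (z : ℂ) (hz : z ∈ unbranchedSet g) : ∃ A', HasDerivAt Y
      ![(A' + -(g z * (g z * A'))) / 2, I * (A' - -(g z * (g z * A'))) / 2, g z * A'] z := by
    obtain ⟨A', hA, hC, hB⟩ := key z hz
    refine ⟨A', hasDerivAt_pi.2 fun j => ?_⟩
    fin_cases j
    · exact (hA.fun_add hB).div_const 2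
    · exact ((hA.fun_sub hB).const_mul I).div_const 2
    · exact hC
  have hN (z : ℂ) (hz : z ∈ regularSet g) : gaussMap g z = ![2 * (g z).re / (‖g z‖ ^ 2 + 1),
      2 * (g z).im / (‖g z‖ ^ 2 + 1), (‖g z‖ ^ 2 - 1) / (‖g z‖ ^ 2 + 1)] :=
    if_neg (not_lt.2 (le_of_eq (Eq.symm hz)))
  have hgg (z : ℂ) : ((‖g z‖ : ℂ)) ^ 2 = g z * starRingEnd ℂ (g z) := (mul_conj' _).symm
  have hre (z : ℂ) : ((g z).re : ℂ) = (g z + starRingEnd ℂ (g z)) / 2 := re_eq_add_conj _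
  have him (z : ℂ) : ((g z).im : ℂ) = (g z - starRingEnd ℂ (g z)) / (2 * I) := im_eq_sub_conj _
  refine ⟨Y, fun z => ?_, fun z hz => ?_, fun z hz => ?_, fun z hz => ?_⟩
  · simp only [Y, A, B, C, hPper, deriv_periodic hPper, deriv_periodic hg.periodic, hg.periodic,
      show h (z + I) = h z from kdvPrimitive_periodic hg.periodic n z]
  · obtain ⟨A', hA⟩ := hY z hz
    exact hA.differentiableAt.differentiableWithinAt
  · obtain ⟨A', hA⟩ := hY z hz
    rw [hA.deriv, hN z hz.1]
    have hρ := one_add_mul_conj_ne_zero (g z)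
    simp only [Fin.sum_univ_three, Matrix.cons_val_zero, Matrix.cons_val_one, Matrix.cons_val,
      ofReal_div, ofReal_mul, ofReal_add, ofReal_sub, ofReal_pow, ofReal_ofNat, ofReal_one, hgg,
      hre, him]
    rw [add_comm] at hρ
    -- The orthogonality is an algebraic identity in `g` and an independent variable in place of its
    -- conjugate.
    generalize starRingEnd ℂ (g z) = c at *
    field_simp
    ring
  · have e : f z = ∑ j, Y z j * (gaussMap g z j : ℂ) := by
      have h0 := hg.mem_regularSet_iff.1 hz.1
      have hz2 := hz.2
      have hρ := one_add_mul_conj_ne_zero (g z)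
      rw [(hJ z hz.1).eq_of_nhds, hN z hz.1, jacobiFun]
      simp only [Y, A, B, C, P, h, Fin.sum_univ_three, Matrix.cons_val_zero, Matrix.cons_val_one,
        Matrix.cons_val, ofReal_div, ofReal_mul, ofReal_add, ofReal_sub, ofReal_pow, ofReal_ofNat,
        ofReal_one, hgg, hre, him]
      rw [add_comm (g z * _) 1]
      generalize starRingEnd ℂ (g z) = c at *
      field_simp
      ring
    dsimp only
    rw [e]
    constructor
    · rw [re_sum]
      exact Finset.sum_congr rfl fun j _ => by simp
    · rw [im_sum]
      exact Finset.sum_congr rfl fun j _ => by simp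

theorem isComplexJacobi {n : ℕ} {g f : ℂ → ℂ} (hg : IsCylMeromorphic g)
    (hf : ContDiff ℝ ∞ f) (hper : ∀ z, f (z + I) = f z)
    (hJ : ∀ z ∈ regularSet g, f =ᶠ[𝓝 z] jacobiFun n g) : IsComplexJacobi g f :=
  ⟨isJacobi_clm_comp hg hf hper hJ reCLM, isJacobi_clm_comp hg hf hper hJ imCLM,
    isConjugateJacobi_re_im hg hJ⟩

/-! ### Limits of translates -/

/-- Locally uniform convergence to a continuous limit is handled as joint convergence in `atTop ×ˢ 𝓝
x`, a form stable under algebraic operations. -/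
theorem tendsto_of_tendsto_uniformity {β : Type*} [UniformSpace β] {f : ℂ → β} {F : ℕ → ℂ → β}
    {x : ℂ} (h : Tendsto (fun q : ℕ × ℂ => (f q.2, F q.1 q.2)) (atTop ×ˢ 𝓝 x) (uniformity β))
    (hf : ContinuousAt f x) :
    Tendsto (fun q : ℕ × ℂ => F q.1 q.2) (atTop ×ˢ 𝓝 x) (𝓝 (f x)) :=
  (hf.tendsto.comp tendsto_snd).congr_uniformity h

theorem tendsto_uniformity_of_tendsto {β : Type*} [UniformSpace β] {f : ℂ → β} {F : ℕ → ℂ → β}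
    {x : ℂ} (h : Tendsto (fun q : ℕ × ℂ => F q.1 q.2) (atTop ×ˢ 𝓝 x) (𝓝 (f x)))
    (hf : ContinuousAt f x) :
    Tendsto (fun q : ℕ × ℂ => (f q.2, F q.1 q.2)) (atTop ×ˢ 𝓝 x) (uniformity β) :=
  ((hf.tendsto.comp tendsto_snd).prodMk_nhds h).mono_right (nhds_le_uniformity _)

/-- Continuous convergence of analytic functions implies that of their derivatives. -/
theorem tendsto_deriv_of_tendsto {φ : ℕ → ℂ → ℂ} {Φ : ℂ → ℂ} {x : ℂ}
    (h : ∀ᶠ y in 𝓝 x, Tendsto (fun q : ℕ × ℂ => φ q.1 q.2) (atTop ×ˢ 𝓝 y) (𝓝 (Φ y)))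
    (hΦ : AnalyticAt ℂ Φ x) (hd : ∀ᶠ q : ℕ × ℂ in atTop ×ˢ 𝓝 x, AnalyticAt ℂ (φ q.1) q.2) :
    Tendsto (fun q : ℕ × ℂ => deriv (φ q.1) q.2) (atTop ×ˢ 𝓝 x) (𝓝 (deriv Φ x)) := by
  obtain ⟨pa, hpa, pb, hpb, hp⟩ := eventually_prod_iff.1 hd
  obtain ⟨r, hr, hball⟩ := Metric.eventually_nhds_iff_ball.1
    (h.and (hΦ.eventually_analyticAt.and hpb))
  have hU : TendstoLocallyUniformlyOn φ Φ atTop (Metric.ball x r) :=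
    (Metric.isOpen_ball.tendstoLocallyUniformlyOn_iff_forall_tendsto).2 fun y hy =>
      tendsto_uniformity_of_tendsto (hball y hy).1 (hball y hy).2.1.continuousAt
  have hD := hU.deriv (hpa.mono fun k hk y hy =>
    (hp hk (hball y hy).2.2).differentiableAt.differentiableWithinAt) Metric.isOpen_ball
  exact tendsto_of_tendsto_uniformity
    ((Metric.isOpen_ball.tendstoLocallyUniformlyOn_iff_forall_tendsto).1 hD x
      (Metric.mem_ball_self hr)) hΦ.deriv.continuousAt

theorem eventually_forall_mem_of_isCompact {K : Set ℂ} (hK : IsCompact K) {p : ℕ → ℂ → Prop}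
    (h : ∀ x ∈ K, ∀ᶠ q : ℕ × ℂ in atTop ×ˢ 𝓝 x, p q.1 q.2) : ∀ᶠ k in atTop, ∀ z ∈ K, p k z := by
  refine hK.induction_on (p := fun s => ∀ᶠ k in atTop, ∀ z ∈ s, p k z) (by simp)
    (fun s t hst ht => ht.mono fun k hk z hz => hk z (hst hz))
    (fun s t hs ht => ?_) fun x hx => ?_
  · filter_upwards [hs, ht] with k h1 h2 z hz
    exact hz.elim (h1 z) (h2 z)
  · obtain ⟨pa, hpa, pb, hpb, hp⟩ := eventually_prod_iff.1 (h x hx)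
    exact ⟨{z | pb z}, mem_nhdsWithin_of_mem_nhds hpb, hpa.mono fun k hk z hz => hp hk hz⟩

/-- Stereographic projection recovers a function from its Gauss map away from the poles. -/
theorem stereographic_gaussMap {g : ℂ → ℂ} {z : ℂ} (h : 0 ≤ meromorphicOrderAt g z) :
    ((gaussMap g z 0 : ℂ) + I * gaussMap g z 1) / (1 - gaussMap g z 2) = g z := by
  rw [gaussMap, if_neg (not_lt.2 h)]
  have h1 : (‖g z‖ : ℂ) ^ 2 + 1 ≠ 0 := by
    have : (0 : ℝ) < ‖g z‖ ^ 2 + 1 := by positivity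
    exact_mod_cast this.ne'
  simp only [Matrix.cons_val]
  push_cast
  conv_rhs => rw [← re_add_im (g z)]
  field_simp
  ring

theorem order_nonneg_of_gaussMap_lt {g : ℂ → ℂ} {z : ℂ} (h : gaussMap g z 2 < 1) :
    0 ≤ meromorphicOrderAt g z := by
  by_contra! hlt
  rw [gaussMap, if_pos hlt] at h
  simp at h

theorem gaussMap_lt_one {g : ℂ → ℂ} {z : ℂ} (h : 0 ≤ meromorphicOrderAt g z) :
    gaussMap g z 2 < 1 := by
  rw [gaussMap, if_neg (not_lt.2 h)]
  simp only [Matrix.cons_val]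
  rw [div_lt_one (by positivity)]
  linarith

theorem continuousAt_gaussMap {g : ℂ → ℂ} {z : ℂ} (h : AnalyticAt ℂ g z) :
    ContinuousAt (gaussMap g) z := by
  have h1 : (fun z => ![2 * (g z).re / (‖g z‖ ^ 2 + 1), 2 * (g z).im / (‖g z‖ ^ 2 + 1),
      (‖g z‖ ^ 2 - 1) / (‖g z‖ ^ 2 + 1)]) =ᶠ[𝓝 z] gaussMap g :=
    h.eventually_analyticAt.mono fun y hy => (if_neg (not_lt.2 hy.meromorphicOrderAt_nonneg)).symm
  refine ContinuousAt.congr ?_ h1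
  have hc := h.continuousAt
  have hn : ‖g z‖ ^ 2 + 1 ≠ 0 := by positivity
  refine continuousAt_pi.2 fun j => ?_
  fin_cases j
  · exact ((continuous_re.continuousAt.comp hc).const_mul 2).div ((hc.norm.pow 2).add_const 1) hn
  · exact ((continuous_im.continuousAt.comp hc).const_mul 2).div ((hc.norm.pow 2).add_const 1) hn
  · exact ((hc.norm.pow 2).sub_const 1).div ((hc.norm.pow 2).add_const 1) hn

theorem IsCylMeromorphic.order_nonpos_of_gaussMap_pos {g : ℂ → ℂ} (hg : IsCylMeromorphic g) {z : ℂ}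
    (h : 0 < gaussMap g z 2) : meromorphicOrderAt g z ≤ 0 := by
  by_contra! hlt
  have h0 : g z = 0 := by
    by_contra h0
    exact hlt.ne' (hg.mem_regularSet_iff.2 h0)
  rw [gaussMap, if_neg (not_lt.2 hlt.le), h0] at h
  simp only [Matrix.cons_val] at h
  norm_num at h

theorem eventually_gaussMap_gt_of_pole {G : ℂ → ℂ} {x : ℂ} (h : meromorphicOrderAt G x < 0) :
    ∀ᶠ y in 𝓝 x, 1 / 2 < gaussMap G y 2 := by
  -- `|G| > 2` puts the third coordinate `(|G|²-1)/(|G|²+1)` above `3/5`.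
  have h1 : ∀ᶠ y in 𝓝[≠] x, 2 < ‖G y‖ :=
    (tendsto_norm_cobounded_atTop.comp
      (tendsto_cobounded_of_meromorphicOrderAt_neg h)).eventually_gt_atTop 2
  rw [eventually_nhdsWithin_iff] at h1
  filter_upwards [h1] with y hy
  by_cases ho : meromorphicOrderAt G y < 0
  · rw [gaussMap, if_pos ho]
    simp only [Matrix.cons_val]
    norm_num
  · have hyx : y ≠ x := by
      rintro rfl
      exact ho h
    have := hy hyx
    rw [gaussMap, if_neg ho]
    simp only [Matrix.cons_val]
    rw [lt_div_iff₀ (by positivity)]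
    nlinarith

/-- By the identity theorem infinite order at one point spreads to all of `ℂ`, which would make `G`
identically `0`. -/
theorem IsCylMeromorphic.order_ne_top {G : ℂ → ℂ} (hG : IsCylMeromorphic G)
    (hc : ¬ ∃ c, ∀ z, G z = c) (x : ℂ) : meromorphicOrderAt G x ≠ ⊤ := by
  intro h
  refine hc ⟨0, fun z => ?_⟩
  by_contra h0
  refine MeromorphicOn.meromorphicOrderAt_ne_top_of_isPreconnected (U := Set.univ)
    (fun y _ => hG.meromorphicAt y) isPreconnected_univ (Set.mem_univ z) (Set.mem_univ x) ?_ h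
  rw [show meromorphicOrderAt G z = 0 from hG.mem_regularSet_iff.2 h0]
  decide

/-- Away from poles of `G` the limiting Gauss map stays off the north pole, so nearby translates
have no pole and stereographic projection, continuous there, transfers the convergence to the
functions. -/
theorem eventually_order_nonneg_and_tendsto {g G : ℂ → ℂ} {a : ℕ → ℂ} (hG : IsCylMeromorphic G)
    (hT : TranslatesTendTo g a G) {x : ℂ} (hx : 0 ≤ meromorphicOrderAt G x) :
    (∀ᶠ q : ℕ × ℂ in atTop ×ˢ 𝓝 x, 0 ≤ meromorphicOrderAt g (q.2 + a q.1)) ∧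
    Tendsto (fun q : ℕ × ℂ => g (q.2 + a q.1)) (atTop ×ˢ 𝓝 x) (𝓝 (G x)) := by
  have h1 := tendsto_of_tendsto_uniformity (F := fun k z => gaussMap g (z + a k))
    (tendstoLocallyUniformly_iff_forall_tendsto.1 hT x)
    (continuousAt_gaussMap (hG.analyticAt_of_order_nonneg hx))
  have h2 (j : Fin 3) : Tendsto (fun q : ℕ × ℂ => gaussMap g (q.2 + a q.1) j) (atTop ×ˢ 𝓝 x)
      (𝓝 (gaussMap G x j)) := (tendsto_pi_nhds.1 h1) j
  have h3 : ∀ᶠ q : ℕ × ℂ in atTop ×ˢ 𝓝 x, 0 ≤ meromorphicOrderAt g (q.2 + a q.1) :=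
    ((h2 2).eventually (gt_mem_nhds (gaussMap_lt_one hx))).mono fun q hq =>
      order_nonneg_of_gaussMap_lt hq
  refine ⟨h3, ?_⟩
  have hne : (1 : ℂ) - gaussMap G x 2 ≠ 0 := by
    have : (0 : ℝ) < 1 - gaussMap G x 2 := sub_pos.2 (gaussMap_lt_one hx)
    exact_mod_cast this.ne'
  have h4 (j : Fin 3) := (continuous_ofReal.tendsto _).comp (h2 j)
  have h5 := ((h4 0).add ((h4 1).const_mul I)).div ((h4 2).const_sub 1) hne
  rw [stereographic_gaussMap hx] at h5
  exact h5.congr' (h3.mono fun q hq => stereographic_gaussMap hq)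

/-- Near a pole of `G` the third coordinate of its Gauss map exceeds `1/2`. A translate within
distance `1/2` has a positive third coordinate, whereas zeros sit at the south pole. -/
theorem eventually_order_nonpos {g G : ℂ → ℂ} {a : ℕ → ℂ} (hg : IsCylMeromorphic g)
    (hT : TranslatesTendTo g a G) {x : ℂ} (hx : meromorphicOrderAt G x < 0) :
    ∀ᶠ q : ℕ × ℂ in atTop ×ˢ 𝓝 x, meromorphicOrderAt g (q.2 + a q.1) ≤ 0 := by
  have h1 := tendstoLocallyUniformly_iff_forall_tendsto.1 hT x
  have h2 := h1.eventually (Metric.dist_mem_uniformity (show (0 : ℝ) < 1 / 2 by norm_num))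
  filter_upwards [h2, tendsto_snd.eventually (eventually_gaussMap_gt_of_pole hx)] with q h3 h4
  refine hg.order_nonpos_of_gaussMap_pos ?_
  have h5 := (dist_le_pi_dist _ _ 2).trans_lt h3
  rw [Real.dist_eq, abs_lt] at h5
  linarith [h5.2]

/-! ### Convergence of rational expressions along translates -/

section Translates

variable {g G : ℂ → ℂ} {a : ℕ → ℂ} (hg : IsCylMeromorphic g) (hG : IsCylMeromorphic G)
  (hT : TranslatesTendTo g a G)
include hg hG hT

theorem eventually_mem_regularSet_translate {x : ℂ} (hx : x ∈ regularSet G) :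
    ∀ᶠ q : ℕ × ℂ in atTop ×ˢ 𝓝 x, q.2 + a q.1 ∈ regularSet g :=
  ((eventually_order_nonneg_and_tendsto hG hT (le_of_eq (Eq.symm hx))).2.eventually_ne
    (hG.mem_regularSet_iff.1 hx)).mono fun _ hq => hg.mem_regularSet_iff.2 hq

theorem tendsto_iteratedDeriv_translate (j : ℕ) {x : ℂ} (hx : x ∈ regularSet G) :
    Tendsto (fun q : ℕ × ℂ => iteratedDeriv j g (q.2 + a q.1)) (atTop ×ˢ 𝓝 x)
      (𝓝 (iteratedDeriv j G x)) := by
  induction j generalizing x with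
  | zero =>
    simpa using (eventually_order_nonneg_and_tendsto hG hT (le_of_eq (Eq.symm hx))).2
  | succ j ih =>
    have h := tendsto_deriv_of_tendsto (φ := fun k z => iteratedDeriv j g (z + a k))
      ((hG.eventually_mem_regularSet hx).mono fun y hy => ih hy)
      (analyticAt_iteratedDeriv (hG.analyticAt hx) j)
      ((eventually_mem_regularSet_translate hg hG hT hx).mono fun q hq => by
        have h1 := analyticAt_iteratedDeriv (hg.analyticAt hq) j
        exact h1.fun_comp_of_eq (f := fun z => z + a q.1) (by fun_prop) rfl)
    simpa only [deriv_comp_add_const, iteratedDeriv_succ] using h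

theorem tendsto_evalDiff_translate (P : DiffPoly) {x : ℂ} (hx : x ∈ regularSet G) :
    Tendsto (fun q : ℕ × ℂ => evalDiff P g (q.2 + a q.1)) (atTop ×ˢ 𝓝 x)
      (𝓝 (evalDiff P G x)) := by
  induction P using MvPolynomial.induction_on with
  | C c => simpa only [evalDiff_C] using tendsto_const_nhds
  | add p q hp hq => simpa only [evalDiff_add] using hp.add hq
  | mul_X p k h =>
    simpa only [evalDiff_mul, evalDiff_X] using
      h.mul (tendsto_iteratedDeriv_translate hg hG hT k hx)

theorem IsRationalFunctional.tendsto_translate {Φ : (ℂ → ℂ) → ℂ → ℂ} (hΦ : IsRationalFunctional Φ)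
    {x : ℂ} (hx : x ∈ regularSet G) :
    Tendsto (fun q : ℕ × ℂ => Φ g (q.2 + a q.1)) (atTop ×ˢ 𝓝 x) (𝓝 (Φ G x)) := by
  obtain ⟨p, m, hp⟩ := hΦ
  have h0 := hG.mem_regularSet_iff.1 hx
  rw [hp G x (hG.analyticAt hx) h0]
  refine ((tendsto_evalDiff_translate hg hG hT p hx).div
    ((eventually_order_nonneg_and_tendsto hG hT (le_of_eq (Eq.symm hx))).2.pow m)
    (pow_ne_zero m h0)).congr' ?_
  filter_upwards [eventually_mem_regularSet_translate hg hG hT hx] with q hq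
  exact (hp g _ (hg.analyticAt hq) (hg.mem_regularSet_iff.1 hq)).symm

theorem tendsto_jacobiFun_translate (n : ℕ) {x : ℂ} (hx : x ∈ regularSet G) :
    Tendsto (fun q : ℕ × ℂ => jacobiFun n g (q.2 + a q.1)) (atTop ×ˢ 𝓝 x)
      (𝓝 (jacobiFun n G x)) := by
  have h1 := (isRationalFunctional_kdvFun n).tendsto_translate hg hG hT hx
  have h2 := (isRationalFunctional_kdvPrimitive n).tendsto_translate hg hG hT hx
  have h3 := (eventually_order_nonneg_and_tendsto hG hT (le_of_eq (Eq.symm hx))).2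
  have h4 := (continuous_conj.tendsto _).comp h3
  exact (h1.const_mul (-4)).add (((h3.const_mul 2).mul h2).div ((h3.mul h4).const_add 1)
    (one_add_mul_conj_ne_zero _))

theorem tendstoLocallyUniformlyOn_jacobi {n : ℕ} {f : ℂ → ℂ}
    (hJ : ∀ z ∈ regularSet g, f z = jacobiFun n g z) :
    TendstoLocallyUniformlyOn (fun k z => f (z + a k)) (jacobiFun n G) atTop (regularSet G) := by
  refine (hG.isOpen_regularSet.tendstoLocallyUniformlyOn_iff_forall_tendsto).2 fun x hx => ?_
  refine tendsto_uniformity_of_tendsto (F := fun k z => f (z + a k)) ?_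
    (contDiffAt_jacobiFun n (hG.analyticAt hx) (hG.mem_regularSet_iff.1 hx)).continuousAt
  refine (tendsto_jacobiFun_translate hg hG hT n hx).congr' ?_
  filter_upwards [eventually_mem_regularSet_translate hg hG hT hx] with q hq
  exact (hJ _ hq).symm

/-- A rational expression converges uniformly on circles that avoid the zeros and poles of the
limit. -/
theorem IsRationalFunctional.exists_bound_translate {Φ : (ℂ → ℂ) → ℂ → ℂ}
    (hΦ : IsRationalFunctional Φ) {K : Set ℂ} (hK : IsCompact K) (hKG : K ⊆ regularSet G) :
    ∃ M, 0 ≤ M ∧ ∀ᶠ k in atTop, ∀ z ∈ K, z + a k ∈ regularSet g ∧ ‖Φ g (z + a k)‖ ≤ M := by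
  have hc : ContinuousOn (Φ G) K := fun x hx =>
    (hΦ.analyticAt (hG.analyticAt (hKG hx))
      (hG.mem_regularSet_iff.1 (hKG hx))).continuousAt.continuousWithinAt
  obtain ⟨M, hM⟩ := hK.exists_bound_of_continuousOn hc
  refine ⟨max 0 (M + 1), le_max_left _ _, eventually_forall_mem_of_isCompact hK fun x hx => ?_⟩
  have h1 : ‖Φ G x‖ < M + 1 := (hM x hx).trans_lt (lt_add_one M)
  filter_upwards [eventually_mem_regularSet_translate hg hG hT (hKG hx),
    (hΦ.tendsto_translate hg hG hT (hKG hx)).norm.eventually (gt_mem_nhds h1)] with q h2 h3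
  exact ⟨h2, h3.le.trans (le_max_right _ _)⟩

end Translates

/-! ### Boundedness -/

/-- The maximum principle for meromorphic functions with removable singularities. -/
theorem norm_le_of_meromorphicOrderAt_nonneg {φ : ℂ → ℂ} {c : ℂ} {r M : ℝ} (hr : 0 < r)
    (hφ : ∀ z, MeromorphicAt φ z) (ho : ∀ z ∈ Metric.closedBall c r, 0 ≤ meromorphicOrderAt φ z)
    (hc : ∀ z ∈ Metric.sphere c r, ContinuousAt φ z) (hM : ∀ z ∈ Metric.sphere c r, ‖φ z‖ ≤ M)
    {z : ℂ} (hz : z ∈ Metric.closedBall c r) (hcz : ContinuousAt φ z) : ‖φ z‖ ≤ M := by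
  have hm : MeromorphicOn φ Set.univ := fun p _ => hφ p
  set ψ := toMeromorphicNFOn φ Set.univ
  have hN : MeromorphicNFOn ψ Set.univ := meromorphicNFOn_toMeromorphicNFOn _ _
  have ha (y : ℂ) (hy : y ∈ Metric.closedBall c r) : AnalyticAt ℂ ψ y := by
    refine (hN (Set.mem_univ y)).meromorphicOrderAt_nonneg_iff_analyticAt.1 ?_
    rw [meromorphicOrderAt_toMeromorphicNFOn hm (Set.mem_univ y)]
    exact ho y hy
  have he (y : ℂ) (hy : y ∈ Metric.closedBall c r) (hcy : ContinuousAt φ y) : ψ y = φ y :=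
    ((ContinuousAt.eventuallyEq_nhds_iff_eventuallyEq_nhdsNE (ha y hy).continuousAt hcy).1
      (hm.toMeromorphicNFOn_eq_self_on_nhdsNE (Set.mem_univ y))).eq_of_nhds
  rw [← he z hz hcz]
  have hd : DiffContOnCl ℂ ψ (Metric.ball c r) := by
    refine DifferentiableOn.diffContOnCl ?_
    rw [closure_ball c hr.ne']
    exact fun y hy => (ha y hy).differentiableAt.differentiableWithinAt
  refine norm_le_of_forall_mem_frontier_norm_le Metric.isBounded_ball hd (fun y hy => ?_)
    (by rwa [closure_ball c hr.ne'])
  rw [frontier_ball c hr.ne'] at hy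
  have hy' := Metric.sphere_subset_closedBall hy
  rw [he y hy' (hc y hy)]
  exact hM y hy

theorem norm_div_one_add_mul_conj_le (w : ℂ) : ‖w / (1 + w * starRingEnd ℂ w)‖ ≤ 1 := by
  have h : 1 + w * starRingEnd ℂ w = ((1 + ‖w‖ ^ 2 : ℝ) : ℂ) := by
    rw [mul_conj']; push_cast; rfl
  have h0 : (0 : ℝ) < 1 + ‖w‖ ^ 2 := by positivity
  rw [h, norm_div, norm_real, Real.norm_of_nonneg h0.le, div_le_one h0]
  nlinarith [sq_nonneg (‖w‖ - 1), norm_nonneg w]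

namespace MemMimm

variable {g : ℂ → ℂ} (hg : MemMimm g)
include hg

/-- A rational expression without poles on a disc is bounded there by its values on the
circle. -/
theorem norm_le_of_isRationalFunctional {Φ : (ℂ → ℂ) → ℂ → ℂ} (hΦ : IsRationalFunctional Φ)
    {c : ℂ} {r M : ℝ} (hr : 0 < r) (ho : ∀ z ∈ Metric.closedBall c r, 0 ≤ meromorphicOrderAt (Φ g) z)
    (hM : ∀ z ∈ Metric.sphere c r, z ∈ regularSet g ∧ ‖Φ g z‖ ≤ M) {z : ℂ}
    (hz : z ∈ Metric.closedBall c r) (hzr : z ∈ regularSet g) : ‖Φ g z‖ ≤ M := by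
  have hc (y : ℂ) (hy : y ∈ regularSet g) : ContinuousAt (Φ g) y :=
    (hΦ.analyticAt (hg.analyticAt hy) (hg.mem_regularSet_iff.1 hy)).continuousAt
  exact norm_le_of_meromorphicOrderAt_nonneg hr
    (fun p => hΦ.meromorphicAt (hg.meromorphicAt p) (hg.eventually_regular p)) ho
    (fun y hy => hc y (hM y hy).1) (fun y hy => (hM y hy).2) hz (hc z hzr)

theorem order_nonneg_of_zero_or_regular (n : ℕ) {z : ℂ} (hz : 0 ≤ meromorphicOrderAt g z) :
    0 ≤ meromorphicOrderAt (fun z => -4 * kdvFun n g z + 2 * g z * kdvPrimitive n g z) z ∧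
    0 ≤ meromorphicOrderAt (fun z => g z ^ 2 * kdvPrimitive n g z) z := by
  rcases hg.order z with h | h | h
  · have ha := hg.analyticAt h
    have h0 := hg.mem_regularSet_iff.1 h
    have hP := (isRationalFunctional_kdvFun n).analyticAt ha h0
    have hh := (isRationalFunctional_kdvPrimitive n).analyticAt ha h0
    exact ⟨AnalyticAt.meromorphicOrderAt_nonneg (by fun_prop),
      AnalyticAt.meromorphicOrderAt_nonneg (by fun_prop)⟩
  · obtain ⟨⟨b, hb, hb'⟩, ⟨k, hk, hk'⟩, -⟩ := hg.expansions_at_zero h n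
    rw [meromorphicOrderAt_congr hb', meromorphicOrderAt_congr hk']
    exact ⟨hb.meromorphicOrderAt_nonneg, hk.meromorphicOrderAt_nonneg⟩
  · rw [h] at hz
    exact absurd hz (by decide)

theorem order_nonneg_of_pole_or_regular (n : ℕ) {z : ℂ} (hz : meromorphicOrderAt g z ≤ 0) :
    0 ≤ meromorphicOrderAt (kdvFun n g) z ∧ 0 ≤ meromorphicOrderAt (kdvPrimitive n g) z := by
  rcases hg.order z with h | h | h
  · have ha := hg.analyticAt h
    have h0 := hg.mem_regularSet_iff.1 h
    exact ⟨((isRationalFunctional_kdvFun n).analyticAt ha h0).meromorphicOrderAt_nonneg,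
      ((isRationalFunctional_kdvPrimitive n).analyticAt ha h0).meromorphicOrderAt_nonneg⟩
  · rw [h] at hz
    exact absurd hz (by decide)
  · obtain ⟨⟨P, hP, hP'⟩, ⟨H, hH, hH'⟩⟩ := hg.expansions_at_pole h n
    rw [meromorphicOrderAt_congr hP', meromorphicOrderAt_congr hH']
    exact ⟨hP.meromorphicOrderAt_nonneg, hH.meromorphicOrderAt_nonneg⟩

/-- Along a sequence for which the translates of `g` converge, the Jacobi function is bounded. -/
theorem exists_bound_of_translatesTendTo (n : ℕ) {f G : ℂ → ℂ} {a : ℕ → ℂ} (hf : Continuous f)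
    (hJ : ∀ z ∈ regularSet g, f z = jacobiFun n g z) (hG : IsCylMeromorphic G)
    (hc : ¬ ∃ c, ∀ z, G z = c) (hT : TranslatesTendTo g a G) :
    ∃ M, ∀ᶠ k in atTop, ‖f (a k)‖ ≤ M := by
  have hgc : IsCylMeromorphic g := hg.toIsCylMeromorphic
  have hreg := hG.eventually_nhdsNE_mem_regularSet (hG.order_ne_top hc 0)
  -- The centre `a k` may itself be a zero or pole of `g`, so the bound is proved at regular points
  -- nearby and passes to the centre by continuity of `f`.
  suffices h : ∃ M, ∃ r > 0, ∀ᶠ k in atTop, ∀ z ∈ Metric.closedBall (a k) r,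
      z ∈ regularSet g → ‖jacobiFun n g z‖ ≤ M by
    obtain ⟨M, r, hr, h⟩ := h
    refine ⟨M, h.mono fun k hk => ?_⟩
    refine le_of_tendsto (hf.norm.continuousAt.mono_left (nhdsWithin_le_nhds (s := {a k}ᶜ))) ?_
    filter_upwards [hg.eventually_regular (a k),
      nhdsWithin_le_nhds (Metric.closedBall_mem_nhds (a k) hr)] with z hz hzb
    have hz' := hg.mem_regularSet_iff.2 hz.2
    rw [hJ z hz']
    exact hk z hzb hz'
  -- Zeros and poles of `G` are isolated, so some small circle about `0` avoids them, and the radius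
  -- can be shrunk until `p` holds on the whole disc.
  have radius {p : ℕ → ℂ → Prop} (hp : ∀ᶠ q : ℕ × ℂ in atTop ×ˢ 𝓝 0, p q.1 q.2) :
      ∃ r > 0, Metric.sphere 0 r ⊆ regularSet G ∧
        ∀ᶠ k in atTop, ∀ z ∈ Metric.closedBall 0 r, p k z := by
    obtain ⟨pa, hpa, pb, hpb, hp⟩ := eventually_prod_iff.1 hp
    obtain ⟨ε, hε, hball⟩ := Metric.eventually_nhds_iff_ball.1
      ((eventually_nhdsWithin_iff.1 hreg).and hpb)
    have hsub : Metric.closedBall (0 : ℂ) (ε / 2) ⊆ Metric.ball 0 ε :=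
      Metric.closedBall_subset_ball (by linarith)
    refine ⟨ε / 2, by linarith, fun z hz => (hball z (hsub (Metric.sphere_subset_closedBall hz))).1
      ?_, hpa.mono fun k hk z hz => hp hk (hball z (hsub hz)).2⟩
    rintro rfl
    simp at hz
    linarith
  have shift {k : ℕ} {z : ℂ} {r : ℝ} (hz : z ∈ Metric.closedBall (a k) r) :
      z - a k ∈ Metric.closedBall 0 r := by simpa [dist_eq_norm] using hz
  have shift' {k : ℕ} {z : ℂ} {r : ℝ} (hz : z ∈ Metric.sphere (a k) r) :
      z - a k ∈ Metric.sphere 0 r := by simpa [dist_eq_norm] using hz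
  have i := IsRationalFunctional.iteratedDeriv_self 0
  simp only [iteratedDeriv_zero] at i
  have rP := isRationalFunctional_kdvFun n
  have rh := isRationalFunctional_kdvPrimitive n
  -- On the disc the translates have no poles in the first case and no zeros in the second.
  -- Accordingly the expressions fed to the maximum principle are `-4P + 2gh` and `g²h`, or `P` and
  -- `h`. This needs convergence only on the circle, not near the singular points inside.
  rcases le_or_gt 0 (meromorphicOrderAt G 0) with h0 | h0
  · have rb := ((IsRationalFunctional.const (-4)).mul rP).add
      (((IsRationalFunctional.const 2).mul i).mul rh)
    have rk := ((i.mul i).mul rh).congr (Ψ := fun g z => g z ^ 2 * kdvPrimitive n g z)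
      fun g z _ _ => by rw [pow_two]
    obtain ⟨r, hr, hsphere, hball⟩ :=
      radius (p := fun k z => 0 ≤ meromorphicOrderAt g (z + a k))
        (eventually_order_nonneg_and_tendsto hG hT h0).1
    obtain ⟨M₁, hM₁, hb⟩ := rb.exists_bound_translate hgc hG hT (isCompact_sphere 0 r) hsphere
    obtain ⟨M₂, hM₂, hk⟩ := rk.exists_bound_translate hgc hG hT (isCompact_sphere 0 r) hsphere
    refine ⟨M₁ + 2 * M₂, r, hr, ?_⟩
    filter_upwards [hball, hb, hk] with k ho hb hk z hz hzr
    have ho' (y : ℂ) (hy : y ∈ Metric.closedBall (a k) r) := hg.order_nonneg_of_zero_or_regular n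
      (by simpa using ho _ (shift hy) : 0 ≤ meromorphicOrderAt g y)
    have e1 := hg.norm_le_of_isRationalFunctional rb hr (fun y hy => (ho' y hy).1)
      (fun y hy => by simpa using hb _ (shift' hy)) hz hzr
    have e2 := hg.norm_le_of_isRationalFunctional rk hr (fun y hy => (ho' y hy).2)
      (fun y hy => by simpa using hk _ (shift' hy)) hz hzr
    have hρ := one_add_mul_conj_ne_zero (g z)
    have e3 : jacobiFun n g z = (-4 * kdvFun n g z + 2 * g z * kdvPrimitive n g z)
        - 2 * ((g z ^ 2 * kdvPrimitive n g z)
          * starRingEnd ℂ (g z / (1 + g z * starRingEnd ℂ (g z)))) := by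
      rw [jacobiFun, map_div₀, map_add, map_mul, map_one, conj_conj]
      rw [mul_comm (starRingEnd ℂ (g z)) (g z)]
      generalize starRingEnd ℂ (g z) = c at *
      field_simp
      ring
    rw [e3]
    refine (norm_sub_le _ _).trans (add_le_add e1 ?_)
    rw [norm_mul, norm_mul, norm_conj, norm_ofNat]
    have := mul_le_mul e2 (norm_div_one_add_mul_conj_le (g z)) (norm_nonneg _) hM₂
    linarith
  · obtain ⟨r, hr, hsphere, hball⟩ :=
      radius (p := fun k z => meromorphicOrderAt g (z + a k) ≤ 0) (eventually_order_nonpos hgc hT h0)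
    obtain ⟨M₁, hM₁, hb⟩ := rP.exists_bound_translate hgc hG hT (isCompact_sphere 0 r) hsphere
    obtain ⟨M₂, hM₂, hk⟩ := rh.exists_bound_translate hgc hG hT (isCompact_sphere 0 r) hsphere
    refine ⟨4 * M₁ + 2 * M₂, r, hr, ?_⟩
    filter_upwards [hball, hb, hk] with k ho hb hk z hz hzr
    have ho' (y : ℂ) (hy : y ∈ Metric.closedBall (a k) r) := hg.order_nonneg_of_pole_or_regular n
      (by simpa using ho _ (shift hy) : meromorphicOrderAt g y ≤ 0)
    have e1 := hg.norm_le_of_isRationalFunctional rP hr (fun y hy => (ho' y hy).1)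
      (fun y hy => by simpa using hb _ (shift' hy)) hz hzr
    have e2 := hg.norm_le_of_isRationalFunctional rh hr (fun y hy => (ho' y hy).2)
      (fun y hy => by simpa using hk _ (shift' hy)) hz hzr
    have e3 : jacobiFun n g z = -4 * kdvFun n g z
        + 2 * (kdvPrimitive n g z * (g z / (1 + g z * starRingEnd ℂ (g z)))) := by
      rw [jacobiFun]; ring
    rw [e3]
    refine (norm_add_le _ _).trans (add_le_add ?_ ?_)
    · rw [norm_mul, norm_neg, norm_ofNat]
      linarith
    · rw [norm_mul, norm_mul, norm_ofNat]
      have := mul_le_mul e2 (norm_div_one_add_mul_conj_le (g z)) (norm_nonneg _) hM₂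
      linarith

theorem exists_bound_jacobi (n : ℕ) {f : ℂ → ℂ} (hf : Continuous f) (hper : ∀ z, f (z + I) = f z)
    (hJ : ∀ z ∈ regularSet g, f z = jacobiFun n g z) : ∃ K : ℝ, ∀ z, ‖f z‖ ≤ K := by
  have hstrip (R : ℝ) : ∃ K : ℝ, ∀ z : ℂ, |z.re| ≤ R → ‖f z‖ ≤ K := by
    have hcomp : IsCompact (Set.Icc (-R) R ×ℂ Set.Icc (0 : ℝ) 1) :=
      isCompact_Icc.reProdIm isCompact_Icc
    obtain ⟨K, hK⟩ := hcomp.exists_bound_of_continuousOn hf.continuousOn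
    refine ⟨K, fun z hz => ?_⟩
    have hp : Function.Periodic f I := hper
    have h1 : f (z - (⌊z.im⌋ : ℤ) • I) = f z := hp.sub_zsmul_eq _
    rw [← h1]
    refine hK _ ⟨?_, ?_⟩
    · simpa [abs_le] using hz
    · have h2 := Int.floor_le z.im
      have h3 := Int.lt_floor_add_one z.im
      simp only [zsmul_eq_mul, Set.mem_preimage, sub_im, mul_im, intCast_re, I_im, mul_one,
        intCast_im, I_re, mul_zero, add_zero, Set.mem_Icc]
      constructor <;> linarith
  by_contra! hunb
  choose K hK using hstrip
  -- The bound `K k` on the strip `|Re z| ≤ k` forces `|Re z_k| > k`, hence divergence; the entry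
  -- `k` makes the values tend to infinity.
  choose z hz using fun k : ℕ => hunb (max (K k) k)
  have hdiv : IsDivergent z := by
    refine tendsto_atTop_mono (fun k => ?_) tendsto_natCast_atTop_atTop
    by_contra! hlt
    exact absurd (hK k (z k) hlt.le) (not_le.2 ((le_max_left _ _).trans_lt (hz k)))
  obtain ⟨φ, hφ, G, hG, hc, hT⟩ := hg.translates z hdiv
  obtain ⟨M, hM⟩ := hg.exists_bound_of_translatesTendTo n hf hJ hG hc hT
  obtain ⟨k, hk, hkM⟩ := (hM.and (eventually_ge_atTop ⌈M⌉₊)).exists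
  have h1 : (φ k : ℝ) < ‖f (z (φ k))‖ := (le_max_right _ _).trans_lt (hz (φ k))
  have h2 : (k : ℝ) ≤ φ k := by exact_mod_cast hφ.le_apply
  have h3 : M ≤ k := (Nat.le_ceil M).trans (by exact_mod_cast hkM)
  simp only [Function.comp] at hk
  linarith

end MemMimm

/-! ### Identification of the flow and of `f(h)`, and the global extension -/

theorem eventually_mem_unbranchedSet {g : ℂ → ℂ} (hg : IsCylMeromorphic g) {z : ℂ}
    (hz : z ∈ unbranchedSet g) : ∀ᶠ y in 𝓝 z, y ∈ unbranchedSet g :=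
  (hg.eventually_mem_regularSet hz.1).and
    ((hg.analyticAt hz.1).deriv.continuousAt.eventually_ne hz.2)

namespace MemMimm

variable {g : ℂ → ℂ} (hg : MemMimm g)
include hg

theorem deriv_of_eventuallyEq_primitive {n : ℕ} {h : ℂ → ℂ}
    (hh : ∀ z ∈ regularSet g, h =ᶠ[𝓝 z] kdvPrimitive n g) {z : ℂ} (hz : z ∈ regularSet g) :
    deriv h z = -4 * kdvFun n g z * deriv g z / g z ^ 2 := by
  rw [(hh z hz).deriv_eq,
    (hasDerivAt_kdvPrimitive n (hg.analyticAt hz) (hg.mem_regularSet_iff.1 hz)).deriv]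

theorem isRationalExpr_of_eventuallyEq_primitive {n : ℕ} {h : ℂ → ℂ}
    (hh : ∀ z ∈ regularSet g, h =ᶠ[𝓝 z] kdvPrimitive n g) : IsRationalExpr g h := by
  obtain ⟨p, m, hp⟩ := isRationalFunctional_kdvPrimitive n
  have e (z : ℂ) : evalDiff (MvPolynomial.X 0 ^ m) g z = g z ^ m := by
    rw [evalDiff_pow, evalDiff_X, iteratedDeriv_zero]
  refine ⟨p, MvPolynomial.X 0 ^ m, ?_, fun z hz => ?_⟩
  · obtain ⟨z, hz⟩ := (hg.eventually_regular 0).exists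
    refine ⟨z, hg.mem_regularSet_iff.2 hz.2, ?_⟩
    rw [e]
    exact pow_ne_zero m hz.2
  · have h0 := hg.mem_regularSet_iff.1 hz
    rw [e, (hh z hz).eq_of_nhds, hp g z (hg.analyticAt hz) h0]
    field_simp

theorem shiffmanFlow_eq_deformationOf {n : ℕ} {h : ℂ → ℂ}
    (hh : ∀ z ∈ regularSet g, h =ᶠ[𝓝 z] kdvPrimitive n g) {z : ℂ} (hz : z ∈ unbranchedSet g) :
    shiffmanFlow g n z = deformationOf g h z := by
  have h1 : (fun w => g w ^ 3 * deriv h w / (2 * deriv g w)) =ᶠ[𝓝 z]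
      fun w => -2 * (g w * kdvFun n g w) := by
    filter_upwards [eventually_mem_unbranchedSet hg.toIsCylMeromorphic hz] with w hw
    have h0 := hg.mem_regularSet_iff.1 hw.1
    have h2 := hw.2
    rw [hg.deriv_of_eventuallyEq_primitive hh hw.1]
    field_simp
    ring
  have ha := hg.analyticAt hz.1
  have h2 : DifferentiableAt ℂ (fun w => g w * kdvFun n g w) z :=
    (ha.fun_mul ((isRationalFunctional_kdvFun n).analyticAt ha
      (hg.mem_regularSet_iff.1 hz.1))).differentiableAt
  rw [deformationOf, h1.deriv_eq, deriv_const_mul _ h2]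
  rfl

theorem jacobiFun_eq_jacobiOf {n : ℕ} {h : ℂ → ℂ}
    (hh : ∀ z ∈ regularSet g, h =ᶠ[𝓝 z] kdvPrimitive n g) {z : ℂ} (hz : z ∈ unbranchedSet g) :
    jacobiFun n g z = jacobiOf g h z := by
  have h0 := hg.mem_regularSet_iff.1 hz.1
  have h2 := hz.2
  rw [jacobiOf, hg.deriv_of_eventuallyEq_primitive hh hz.1, (hh z hz.1).eq_of_nhds, jacobiFun,
    ← mul_conj']
  congr 1
  field_simp

/-- The global smooth extension of `f(h)`. -/
theorem exists_smooth_periodic_extension (n : ℕ) : ∃ f : ℂ → ℂ, ContDiff ℝ ∞ f ∧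
    (∀ z, f (z + I) = f z) ∧ ∀ z ∈ regularSet g, f =ᶠ[𝓝 z] jacobiFun n g := by
  obtain ⟨f, hf, hJ⟩ := exists_contDiff_extension (hg.exists_smooth_jacobiFun n)
  have hreg (z : ℂ) (hz : z ∈ regularSet g) : f =ᶠ[𝓝 z] jacobiFun n g :=
    (ContinuousAt.eventuallyEq_nhds_iff_eventuallyEq_nhdsNE hf.continuous.continuousAt
      (contDiffAt_jacobiFun n (hg.analyticAt hz) (hg.mem_regularSet_iff.1 hz)).continuousAt).1
      (hJ z).symm
  -- Periodicity is visible only where `f` is given by the formula; density and continuity extend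
  -- it.
  have hdense : Dense (regularSet g) := fun z => by
    refine mem_closure_iff_frequently.2 ?_
    have h1 : ∀ᶠ y in 𝓝[≠] z, y ∈ regularSet g :=
      (hg.eventually_regular z).mono fun y hy => hg.mem_regularSet_iff.2 hy.2
    exact h1.frequently.filter_mono nhdsWithin_le_nhds
  refine ⟨f, hf, congrFun (Continuous.ext_on hdense (hf.continuous.comp (continuous_add_const I))
    hf.continuous fun z hz => ?_), hreg⟩
  have hz' : z + I ∈ regularSet g := by
    rw [hg.mem_regularSet_iff, hg.periodic]
    exact hg.mem_regularSet_iff.1 hz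
  change f (z + I) = f z
  rw [(hreg _ hz').eq_of_nhds, (hreg z hz).eq_of_nhds, jacobiFun, jacobiFun, hg.periodic,
    kdvPrimitive_periodic hg.periodic, kdvFun, evalDiff_periodic (potential_periodic hg.periodic)]

end MemMimm

end

end Shiffman

theorem theorem5p7 (g : ℂ → ℂ) (hg : Shiffman.MemMimm g) (n : ℕ) :
    Shiffman.MemTangent g (Shiffman.shiffmanFlow g n) ∧
    ∃ h : ℂ → ℂ, Shiffman.IsCylMeromorphic h ∧ Shiffman.IsRationalExpr g h ∧
      (∀ z ∈ Shiffman.unbranchedSet g,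
        Shiffman.shiffmanFlow g n z = Shiffman.deformationOf g h z) ∧
      ∃ f : ℂ → ℂ,
        (∀ z ∈ Shiffman.unbranchedSet g, f z = Shiffman.jacobiOf g h z) ∧
        Shiffman.IsComplexJacobi g f ∧
        (ContDiff ℝ (⊤ : ℕ∞) f ∧ ∃ K : ℝ, ∀ z, ‖f z‖ ≤ K) ∧
        Shiffman.IsQuasiperiodicJacobi g f := by
  obtain ⟨h, hcyl, hh⟩ := hg.exists_cylMeromorphic_primitive n
  obtain ⟨f, hf, hper, hJ⟩ := hg.exists_smooth_periodic_extension n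
  have hgc : Shiffman.IsCylMeromorphic g := hg.toIsCylMeromorphic
  have hJ' : ∀ z ∈ Shiffman.regularSet g, f z = Shiffman.jacobiFun n g z :=
    fun z hz => (hJ z hz).eq_of_nhds
  refine ⟨hg.memTangent_shiffmanFlow n, h, hcyl, hg.isRationalExpr_of_eventuallyEq_primitive hh,
    fun z hz => hg.shiffmanFlow_eq_deformationOf hh hz, f,
    fun z hz => (hJ' z hz.1).trans (hg.jacobiFun_eq_jacobiOf hh hz),
    Shiffman.isComplexJacobi hgc hf hper hJ,
    ⟨hf, hg.exists_bound_jacobi n hf.continuous hper hJ'⟩, fun a ha => ?_⟩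
  obtain ⟨φ, hφ, G, hG, hc, hT⟩ := hg.translates a ha
  -- The limit of the translates of `f` is the same expression formed with `G` on its regular set.
  exact ⟨φ, hφ, G, hG, hc, hT, _, Shiffman.tendstoLocallyUniformlyOn_jacobi hgc hG hT hJ'⟩
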